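/- An abstract simplicial complex on an ordinal $\gamma$ is a family $K$ of nonempty finite subsets (faces) of $\gamma=\{\alpha : \alpha<\gamma\}$ that contains every singleton and every nonempty subset of each of its members; a face with $k+1$ elements has dimension $k$, and the dimension of $K$ is the supremum of the dimensions of its faces. For $\alpha<\gamma$, let $K|_{[\alpha,\gamma)}$ be the complex of the faces of $K$ contained in $[\alpha,\gamma)=\{\xi : \alpha\le\xi<\gamma\}$. Let $n$ be a positive integer. Call $K$ \emph{tail-acyclic} (for $n$) if every $n$-element subset of $\gamma$ is a face of $K$ (that is, $K$ has a complete $(n-1)$-skeleton) and, for every $\alpha<\gamma$ and every $k\ge 0$, the reduced simplicial homology group with integer coefficients $\tilde{\mathrm H}_k(K|_{[\alpha,\gamma)})$ vanishes. Then $\omega_n$ is the least ordinal $\gamma$ on which there is no tail-acyclic simplicial complex of dimension at most $n$. Moreover, $\omega_n$ is the least ordinal $\gamma>n$ on which there is no tail-acyclic simplicial complex of dimension exactly $n$. (If $\gamma\le n$ is a natural number, then no complex on $\gamma$ has dimension $n$, for lack of vertices.) -/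

import Mathlib

universe u

noncomputable section

namespace TailAcyclic

variable {V : Type*}

/-- `K^k`: the `k`-dimensional faces of `K`, that is, its faces with `k + 1` vertices. -/
def kFaces (K : PreAbstractSimplicialComplex V) (k : ℕ) : Set (Finset V) :=
  {s | s ∈ K.faces ∧ s.card = k + 1}

/-- The dimension `sup {k | K^k ≠ ∅}`; the complex without faces has dimension `⊥`. -/
def dimension (K : PreAbstractSimplicialComplex V) : WithBot ℕ∞ :=
  ⨆ (k : ℕ) (_ : (kFaces K k).Nonempty), (((k : ℕ∞) : WithBot ℕ∞))

/-- The restriction of `K` to a set `A` of vertices: the faces of `K` contained in `A`. -/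
def restrict (K : PreAbstractSimplicialComplex V) (A : Set V) : PreAbstractSimplicialComplex V where
  faces := {s | s ∈ K.faces ∧ (s : Set V) ⊆ A}
  isRelLowerSet_faces := fun _ hs =>
    ⟨(K.isRelLowerSet_faces hs.1).1, fun _ hts ht =>
      ⟨(K.isRelLowerSet_faces hs.1).2 hts ht, fun _ hx => hs.2 (hts hx)⟩⟩

/-- `C_k(K)`, the free abelian group on the `k`-dimensional faces of `K`. -/
abbrev Chain (K : PreAbstractSimplicialComplex V) (k : ℕ) : Type _ := kFaces K k →₀ ℤ

section Homology

variable [LinearOrder V]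

/-- The face of `s` obtained by omitting the vertex `v`. -/
def eraseVertex (K : PreAbstractSimplicialComplex V) (k : ℕ) (s : kFaces K (k + 1))
    (v : {v // v ∈ s.1}) : kFaces K k :=
  ⟨s.1.erase v.1, by
    have hc : (s.1.erase v.1).card = k + 1 := by
      rw [Finset.card_erase_of_mem v.2, s.2.2]; rfl
    exact ⟨(K.isRelLowerSet_faces s.2.1).2 (Finset.erase_subset _ _)
      (Finset.card_pos.1 (by omega)), hc⟩⟩

/-- The index of `v` in the increasing enumeration, from `0` on, of the vertices of `s`:
the number of elements of `s` below `v`. -/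
def position (s : Finset V) (v : V) : ℕ := (s.filter (· < v)).card

/-- The boundary homomorphism `C_{k+1}(K) → C_k(K)`, sending `⟨s⟩` to the sum over `i` of
`(-1)^i` times the face of `s` that omits the `i`-th vertex of `s`. -/
def boundary (K : PreAbstractSimplicialComplex V) (k : ℕ) : Chain K (k + 1) →ₗ[ℤ] Chain K k :=
  Finsupp.linearCombination ℤ fun s =>
    ∑ v : {v // v ∈ s.1}, Finsupp.single (eraseVertex K k s v) ((-1 : ℤ) ^ position s.1 v.1)

/-- The augmentation `C_0(K) → ℤ`, sending each vertex to `1`. -/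
def augmentation (K : PreAbstractSimplicialComplex V) : Chain K 0 →ₗ[ℤ] ℤ :=
  Finsupp.linearCombination ℤ fun _ => (1 : ℤ)

/-- The kernel of the differential out of `C_k(K)` in the augmented chain complex. -/
def reducedCycles (K : PreAbstractSimplicialComplex V) : (k : ℕ) → Submodule ℤ (Chain K k)
  | 0 => LinearMap.ker (augmentation K)
  | k + 1 => LinearMap.ker (boundary K k)

theorem position_erase_of_lt (s : Finset V) (v w : V) (hv : v ∈ s) (h : v < w) :
    position (s.erase v) w + 1 = position s w := by
  unfold position
  rw [Finset.filter_erase, Finset.card_erase_add_one]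
  simp [hv, h]

theorem position_erase_of_not_lt (s : Finset V) (v w : V) (h : ¬ v < w) :
    position (s.erase v) w = position s w := by
  unfold position
  rw [Finset.filter_erase, Finset.erase_eq_of_notMem]
  simp [h]

theorem sign_cancel (s : Finset V) (v w : V) (hv : v ∈ s) (hw : w ∈ s) (hvw : v ≠ w) :
    (-1 : ℤ) ^ position s v * (-1) ^ position (s.erase v) w +
      (-1 : ℤ) ^ position s w * (-1) ^ position (s.erase w) v = 0 := by
  rcases lt_or_gt_of_ne hvw with h | h
  · rw [← position_erase_of_lt s v w hv h, position_erase_of_not_lt s w v h.not_gt, pow_succ]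
    ring
  · rw [← position_erase_of_lt s w v hw h, position_erase_of_not_lt s v w h.not_gt, pow_succ]
    ring

theorem boundary_boundary (K : PreAbstractSimplicialComplex V) (k : ℕ) :
    boundary K k ∘ₗ boundary K (k + 1) = 0 := by
  refine Finsupp.lhom_ext' fun s => LinearMap.ext_ring ?_
  simp only [boundary, LinearMap.comp_apply, Finsupp.lsingle_apply,
    Finsupp.linearCombination_single, one_smul, map_sum, Finset.smul_sum, Finsupp.smul_single,
    smul_eq_mul, LinearMap.zero_apply]
  rw [Finset.sum_sigma']
  refine Finset.sum_involution
    (fun p _ => ⟨⟨p.2.1, Finset.mem_of_mem_erase p.2.2⟩,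
      ⟨p.1.1, Finset.mem_erase.2 ⟨(Finset.ne_of_mem_erase p.2.2).symm, p.1.2⟩⟩⟩) ?_ ?_ ?_ ?_
  · rintro ⟨v, w⟩ -
    have hface : eraseVertex K k (eraseVertex K (k + 1) s
        ⟨w.1, Finset.mem_of_mem_erase w.2⟩)
        ⟨v.1, Finset.mem_erase.2 ⟨(Finset.ne_of_mem_erase w.2).symm, v.2⟩⟩ =
        eraseVertex K k (eraseVertex K (k + 1) s v) w :=
      Subtype.ext Finset.erase_right_comm
    dsimp only
    rw [hface, ← Finsupp.single_add]
    simp only [eraseVertex]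
    rw [sign_cancel s.1 v.1 w.1 v.2 (Finset.mem_of_mem_erase w.2)
      (Finset.ne_of_mem_erase w.2).symm, Finsupp.single_zero]
  · rintro ⟨v, w⟩ - - h
    exact Finset.ne_of_mem_erase w.2 (congrArg (fun p => p.1.1) h)
  · intro _ _
    exact Finset.mem_univ _
  · rintro ⟨v, w⟩ -
    rfl

theorem augmentation_boundary (K : PreAbstractSimplicialComplex V) :
    augmentation K ∘ₗ boundary K 0 = 0 := by
  refine Finsupp.lhom_ext' fun s => LinearMap.ext_ring ?_
  have key : ∑ x : {x // x ∈ s.1}, (-1 : ℤ) ^ position s.1 x.1 = 0 := by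
    rw [Finset.sum_coe_sort s.1 (fun x => (-1 : ℤ) ^ position s.1 x)]
    obtain ⟨v, w, hvw, hs⟩ := Finset.card_eq_two.1 s.2.2
    rw [hs, Finset.sum_pair hvw]
    rcases lt_or_gt_of_ne hvw with h | h <;>
      simp [position, Finset.filter_insert, Finset.filter_singleton, h, h.not_gt]
  simp only [boundary, augmentation, LinearMap.comp_apply, Finsupp.lsingle_apply,
    Finsupp.linearCombination_single, one_smul, map_sum, smul_eq_mul, mul_one,
    LinearMap.zero_apply]
  exact key

/-- Boundaries are reduced cycles, so the quotient below is the homology of a complex. -/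
theorem range_boundary_le (K : PreAbstractSimplicialComplex V) :
    ∀ k : ℕ, LinearMap.range (boundary K k) ≤ reducedCycles K k
  | 0 => LinearMap.range_le_ker_iff.2 (augmentation_boundary K)
  | k + 1 => LinearMap.range_le_ker_iff.2 (boundary_boundary K k)

/-- The `k`-th reduced simplicial homology group of `K`: reduced cycles modulo boundaries. -/
abbrev ReducedHomology (K : PreAbstractSimplicialComplex V) (k : ℕ) : Type _ :=
  reducedCycles K k ⧸ (LinearMap.range (boundary K k)).submoduleOf (reducedCycles K k)

/-- `K` has a complete `(n - 1)`-skeleton (for `n ≥ 1`), and all reduced homology of the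
restriction of `K` to each tail of the vertex set vanishes. -/
structure IsTailAcyclic (n : ℕ) (K : AbstractSimplicialComplex V) : Prop where
  complete_skeleton : ∀ s : Finset V, s.card = n → s ∈ K.faces
  acyclic : ∀ (α : V) (k : ℕ),
    Subsingleton (ReducedHomology (restrict K.toPreAbstractSimplicialComplex (Set.Ici α)) k)

end Homology

/-- The ordinal `γ` (as the set of its elements) carries a tail-acyclic simplicial complex that is
`n`-dimensional in the sense of having no faces of dimension above `n`. -/
def Supports (n : ℕ) (γ : Ordinal.{u}) : Prop :=
  ∃ K : AbstractSimplicialComplex (Set.Iio γ),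
    dimension K.toPreAbstractSimplicialComplex ≤ (n : ℕ∞) ∧ IsTailAcyclic n K

/-- The same with dimension exactly `n`. -/
def SupportsExactly (n : ℕ) (γ : Ordinal.{u}) : Prop :=
  ∃ K : AbstractSimplicialComplex (Set.Iio γ),
    dimension K.toPreAbstractSimplicialComplex = (n : ℕ∞) ∧ IsTailAcyclic n K

end TailAcyclic

end

-- Nonexistence at `ω_n`. The unreduced chain complex of a tail-acyclic complex, filtered by the
-- least vertex of a face, has the same homology at every level of the filtration: ℤ in degree 0.
-- `ConstantHomology` abstracts this to a filtered free complex `U` whose levels all include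
-- isomorphically on homology, with a nonzero class in degree `m`. Suppose that every set of at most
-- `ℵ_n` indices has a strict upper bound. A Löwenheim–Skolem closure (`exists_closed_part`) gives a
-- subcomplex `S` of size at most `ℵ_n`, with the homology of `U`, lying strictly below some index
-- `δ`; the part `D` at or above `δ` also has the homology of `U`. In the long exact sequence of `S
-- ⊕ D → U`, the map on homology is the sum of two isomorphisms, so the homology of `U / (S ⊕ D)` is
-- that of `U` moved up one degree (`quotient`). The indices below `δ` are still strictly bounded
-- for sets of size below `ℵ_n`. Thus each step spends one aleph and gains one degree. After `n`
-- steps the class sits in the top degree, where there are no boundaries, yet it can be pushed above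
-- its own support; this is absurd.
--
-- Existence below `ω_n`. By induction on `n`, a vertex set of size below `ℵ_n` carries `n`-faces
-- that, with the complete `(n-1)`-skeleton, make every nonempty upper part acyclic
-- (`exists_acyclic_family`). For `n + 1`, the vertices are re-enumerated in type at most `ω_n`, so
-- that the earlier vertices of each `b` form a set of size below `ℵ_n`; the inductive family on
-- them is coned off with apex `b`. A cycle is then pushed down along the enumeration
-- (`isAcyclicOn_insertFamily`).
--
-- Exact dimension. Once there are more than `n` vertices, the boundary of an `n`-simplex has to
-- bound, which forces an `n`-face (`kFaces_nonempty`).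

universe v

namespace TailAcyclic

open Cardinal Finsupp

/-! ### Strict bounds, cardinal arithmetic and closure of small sets. -/

/-- Every subset of `J` with fewer than `κ` elements has a strict upper bound in `J`. -/
def StrictlyBounded {W : Type v} [LT W] (J : Set W) (κ : Cardinal.{v}) : Prop :=
  ∀ X ⊆ J, #X < κ → ∃ w ∈ J, ∀ x ∈ X, x < w

theorem isRegular_aleph_natCast (n : ℕ) : (ℵ_ (n : Ordinal.{v})).IsRegular := by
  cases n with
  | zero => simpa using isRegular_aleph0
  | succ n => exact_mod_cast isRegular_aleph_add_one (n : Ordinal.{v})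

theorem strictlyBounded_univ {W : Type v} [LinearOrder W] {κ : Cardinal.{v}}
    (h : κ ≤ Order.cof W) : StrictlyBounded (Set.univ : Set W) κ := by
  intro X _ hX
  have hc : ¬ IsCofinal X := fun hc => ((hX.trans_le h).trans_le (Order.cof_le hc)).false
  simp only [IsCofinal, not_forall, not_exists, not_and, not_le] at hc
  obtain ⟨w, hw⟩ := hc
  exact ⟨w, Set.mem_univ _, hw⟩

theorem mk_iUnion_le_of_le {ι E : Type v} {κ : Cardinal.{v}} (hκ : ℵ₀ ≤ κ) (hι : #ι ≤ κ)
    (f : ι → Set E) (hf : ∀ i, #(f i) ≤ κ) : #(⋃ i, f i) ≤ κ :=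
  (mk_iUnion_le f).trans
    ((mul_le_mul' hι (ciSup_le' hf)).trans (mul_eq_self hκ).le)

theorem mk_union_le_of_le {E : Type v} {κ : Cardinal.{v}} (hκ : ℵ₀ ≤ κ) {s t : Set E}
    (hs : #s ≤ κ) (ht : #t ≤ κ) : #(s ∪ t : Set E) ≤ κ :=
  (mk_union_le s t).trans (add_le_of_le hκ hs ht)

theorem mk_finset_le_of_le {E : Type v} {κ : Cardinal.{v}} (hκ : ℵ₀ ≤ κ) (h : #E ≤ κ) :
    #(Finset E) ≤ κ := by
  classical
  exact (mk_le_of_surjective (f := List.toFinset (α := E)) List.toFinset_surjective).trans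
    ((mk_list_le_max E).trans (max_le hκ h))

/-- One step of the closure process. -/
def closureStep {E : Type v} (g : Finset E → Set E) (next : Set E → E) (T : Set E) : Set E :=
  (T ∪ {next T}) ∪ ⋃ A : Finset T, g (A.map (Function.Embedding.subtype _))

/-- `S` is the union of a chain of closure steps of length `κ`. Countable values of `g` keep every
stage of size at most `κ`. By regularity, fewer than `κ` elements of `S` already lie in one stage
`T`, and `next T` enters at the following step. -/
theorem exists_closed_chain {E : Type v} {κ : Cardinal.{v}} (hκ : κ.IsRegular) (U : Set E)
    (g : Finset E → Set E) (hg : ∀ A, (g A).Countable) (hgU : ∀ A, g A ⊆ U)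
    (next : Set E → E) (hn : ∀ T, next T ∈ U) :
    ∃ S ⊆ U, #S ≤ κ ∧ (∀ A : Finset E, (A : Set E) ⊆ S → g A ⊆ S) ∧
      ∀ X ⊆ S, #X < κ → ∃ T, X ⊆ T ∧ T ⊆ U ∧ #T ≤ κ ∧ next T ∈ S := by
  classical
  have h0 := hκ.aleph0_le
  let I := κ.ord.ToType
  have hI : #I = κ := by simp [I]
  have hbdd : StrictlyBounded (Set.univ : Set I) κ := strictlyBounded_univ (by
    simp [I, hκ.cof_ord])
  obtain ⟨F, hF⟩ : ∃ F : I → Set E, ∀ i, F i = closureStep g next (⋃ j : Set.Iio i, F j) :=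
    ⟨WellFoundedLT.fix fun i ih => closureStep g next (⋃ j : Set.Iio i, ih j.1 j.2),
      fun i => WellFoundedLT.fix_eq _ i⟩
  let P : I → Set E := fun i => ⋃ j : Set.Iio i, F j
  have hPF : ∀ i, P i ⊆ F i := fun i => by
    rw [hF i]
    exact Set.subset_union_left.trans Set.subset_union_left
  have hFP : ∀ {j i}, j < i → F j ⊆ P i := fun {j i} h =>
    Set.subset_iUnion (fun j : Set.Iio i => F j) ⟨j, h⟩
  have hnext : ∀ i, next (P i) ∈ F i := fun i => by
    rw [hF i]
    exact Or.inl (Or.inr rfl)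
  have hclosed : ∀ i (A : Finset E), (A : Set E) ⊆ P i → g A ⊆ F i := fun i A hA => by
    rw [hF i]
    refine fun x hx => Or.inr (Set.mem_iUnion.2 ⟨A.subtype (· ∈ P i), ?_⟩)
    rwa [Finset.subtype_map_of_mem fun x hx => hA hx]
  have hFU : ∀ i, F i ⊆ U := fun i => by
    induction i using WellFoundedLT.induction with
    | ind i ih =>
      rw [hF i]
      exact Set.union_subset (Set.union_subset (Set.iUnion_subset fun j => ih j.1 j.2)
        (Set.singleton_subset_iff.2 (hn _))) (Set.iUnion_subset fun A => hgU _)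
  have hFc : ∀ i, #(F i) ≤ κ := fun i => by
    induction i using WellFoundedLT.induction with
    | ind i ih =>
      have hP : #(P i) ≤ κ := mk_iUnion_le_of_le h0
        ((mk_set_le _).trans hI.le) _ fun j => ih j.1 j.2
      rw [hF i]
      refine mk_union_le_of_le h0 (mk_union_le_of_le h0 hP ?_) ?_
      · rw [mk_singleton]
        exact one_le_aleph0.trans h0
      · exact mk_iUnion_le_of_le h0 (mk_finset_le_of_le h0 hP) _
          fun A => (le_aleph0_iff_set_countable.2 (hg _)).trans h0
  have hstage : ∀ X ⊆ ⋃ i, F i, #X < κ → ∃ i, X ⊆ P i := by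
    intro X hX hXc
    have h : ∀ x : X, ∃ i, x.1 ∈ F i := fun x => Set.mem_iUnion.1 (hX x.2)
    choose f hf using h
    obtain ⟨i, -, hi⟩ := hbdd (Set.range f) (Set.subset_univ _) (mk_range_le.trans_lt hXc)
    exact ⟨i, fun x hx => hFP (hi _ ⟨⟨x, hx⟩, rfl⟩) (hf ⟨x, hx⟩)⟩
  refine ⟨⋃ i, F i, Set.iUnion_subset hFU, mk_iUnion_le_of_le h0 hI.le _ hFc, ?_, ?_⟩
  · intro A hA
    obtain ⟨i, hi⟩ := hstage A hA ((lt_aleph0_of_finite _).trans_le h0)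
    exact (hclosed i A hi).trans (Set.subset_iUnion F i)
  · intro X hX hXc
    obtain ⟨i, hi⟩ := hstage X hX hXc
    exact ⟨P i, hi, (hPF i).trans (hFU i),
      (mk_le_mk_of_subset (hPF i)).trans (hFc i), Set.mem_iUnion.2 ⟨i, hnext i⟩⟩

/-! ### Chains supported on a set of basis elements, and coordinate projections. -/

/-- The chains supported on `U`. -/
abbrev chains {E : Type*} (U : Set E) : Submodule ℤ (E →₀ ℤ) := supported ℤ ℤ U

open Classical in
/-- The projection of chains onto the chains supported on `U`. -/
noncomputable def proj {E : Type*} (U : Set E) : (E →₀ ℤ) →ₗ[ℤ] (E →₀ ℤ) :=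
  (chains U).subtype ∘ₗ restrictDom ℤ ℤ U

section Chains

variable {E : Type*} {U R X : Set E}

theorem proj_apply_of_mem {e : E} (he : e ∈ U) (x : E →₀ ℤ) : proj U x e = x e := by
  classical
  simp [proj, restrictDom_apply, he]

theorem proj_apply_of_notMem {e : E} (he : e ∉ U) (x : E →₀ ℤ) : proj U x e = 0 := by
  classical
  simp [proj, restrictDom_apply, he]

theorem mem_chains_iff {x : E →₀ ℤ} : x ∈ chains U ↔ ∀ e, x e ≠ 0 → e ∈ U := by
  rw [mem_supported]
  exact ⟨fun h e he => h (Finsupp.mem_support_iff.2 he),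
    fun h e he => h e (Finsupp.mem_support_iff.1 he)⟩

theorem mem_chains_inter {x : E →₀ ℤ} : x ∈ chains (U ∩ R) ↔ x ∈ chains U ∧ x ∈ chains R := by
  simp only [mem_chains_iff, Set.mem_inter_iff]
  exact ⟨fun h => ⟨fun e he => (h e he).1, fun e he => (h e he).2⟩,
    fun h e he => ⟨h.1 e he, h.2 e he⟩⟩

theorem chains_mono (h : U ⊆ R) : chains U ≤ chains R := supported_mono h

theorem proj_mem (x : E →₀ ℤ) : proj U x ∈ chains U := by
  rw [mem_chains_iff]
  intro e he
  by_contra h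
  exact he (proj_apply_of_notMem h x)

theorem proj_mem_of_mem {x : E →₀ ℤ} (hx : x ∈ chains X) : proj U x ∈ chains X := by
  rw [mem_chains_iff] at hx ⊢
  intro e he
  by_cases h : e ∈ U
  · exact hx e (by rwa [proj_apply_of_mem h] at he)
  · exact absurd (proj_apply_of_notMem h x) he

theorem proj_of_mem {x : E →₀ ℤ} (hx : x ∈ chains U) : proj U x = x := by
  rw [mem_chains_iff] at hx
  ext e
  by_cases h : e ∈ U
  · exact proj_apply_of_mem h x
  · rw [proj_apply_of_notMem h]
    by_contra h'
    exact h (hx e (Ne.symm h'))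

theorem proj_eq_zero {x : E →₀ ℤ} (hx : x ∈ chains Uᶜ) : proj U x = 0 := by
  rw [mem_chains_iff] at hx
  ext e
  by_cases h : e ∈ U
  · rw [proj_apply_of_mem h]
    by_contra h'
    exact hx e h' h
  · exact proj_apply_of_notMem h x

theorem sub_proj_mem {x : E →₀ ℤ} (hx : x ∈ chains X) : x - proj U x ∈ chains (X \ U) := by
  rw [mem_chains_iff] at hx ⊢
  intro e he
  by_cases h : e ∈ U
  · simp [proj_apply_of_mem h] at he
  · refine ⟨hx e ?_, h⟩
    simpa [proj_apply_of_notMem h] using he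

theorem eq_zero_of_mem_chains {x : E →₀ ℤ} (hU : x ∈ chains U) (hR : x ∈ chains R)
    (h : Disjoint U R) : x = 0 := by
  rw [mem_chains_iff] at hU hR
  ext e
  by_contra he
  exact Set.disjoint_left.1 h (hU e he) (hR e he)

theorem exists_add_of_mem_chains_union {x : E →₀ ℤ} (hx : x ∈ chains (U ∪ R)) :
    ∃ s ∈ chains U, ∃ t ∈ chains R, x = s + t := by
  rw [chains, supported_union] at hx
  obtain ⟨s, hs, t, ht, h⟩ := Submodule.mem_sup.1 hx
  exact ⟨s, hs, t, ht, h.symm⟩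

theorem map_mem_chains {F : Type*} {d : (E →₀ ℤ) →ₗ[ℤ] (F →₀ ℤ)} {B : Set F}
    (h : ∀ e ∈ U, d (single e 1) ∈ chains B) {x : E →₀ ℤ} (hx : x ∈ chains U) :
    d x ∈ chains B := by
  rw [chains, supported_eq_span_single] at hx
  induction hx using Submodule.span_induction with
  | mem y hy => obtain ⟨e, he, rfl⟩ := hy; exact h e he
  | zero => simp
  | add y z _ _ hy hz => rw [map_add]; exact add_mem hy hz
  | smul a y _ hy => rw [map_smul]; exact Submodule.smul_mem _ a hy

/-- Used with `A` and `B` the basis elements of consecutive degrees: a map that lowers degree by one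
commutes with taking homogeneous parts. -/
theorem map_proj {d : (E →₀ ℤ) →ₗ[ℤ] (E →₀ ℤ)} {A B : Set E}
    (h : ∀ e ∈ U ∩ A, d (single e 1) ∈ chains B) (h' : ∀ e ∈ U \ A, d (single e 1) ∈ chains Bᶜ)
    {y : E →₀ ℤ} (hy : y ∈ chains U) : d (proj A y) = proj B (d y) := by
  have h1 : proj B (d (y - proj A y)) = 0 := proj_eq_zero (map_mem_chains h' (sub_proj_mem hy))
  rw [map_sub, map_sub, sub_eq_zero] at h1
  rw [h1]
  exact (proj_of_mem (map_mem_chains h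
    (mem_chains_inter.2 ⟨proj_mem_of_mem hy, proj_mem y⟩))).symm

theorem countable_chains (A : Finset E) : ((chains (A : Set E) : Set (E →₀ ℤ))).Countable := by
  classical
  have : Countable (chains (A : Set E)) := (supportedEquivFinsupp (M := ℤ) (R := ℤ)
    (A : Set E)).toEquiv.countable_iff.2 inferInstance
  exact Set.countable_coe_iff.1 this

end Chains

/-! ### Filtered complexes with constant homology, and the degree shift. -/

section ConstantHomology

variable {E W : Type v} [LinearOrder W]

/-- A filtered graded complex with basis `U` (relative to `d`, whose values on the chains on `U`
are again such chains) whose homology is the same at all levels of the filtration and does not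
vanish in degree `m`. -/
structure ConstantHomology (idx : E → W) (deg : E → ℕ) (U : Set E) (J : Set W)
    (d : (E →₀ ℤ) →ₗ[ℤ] (E →₀ ℤ)) (m : ℕ) : Prop where
  map_single : ∀ e ∈ U, d (single e 1) ∈ chains {x ∈ U | idx e ≤ idx x ∧ deg x + 1 = deg e}
  sq : ∀ x ∈ chains U, d (d x) = 0
  idx_mem : ∀ e ∈ U, idx e ∈ J
  inj : ∀ α ∈ J, ∀ y ∈ chains U, d y ∈ chains (U ∩ {e | α ≤ idx e}) →
    ∃ y' ∈ chains (U ∩ {e | α ≤ idx e}), d y' = d y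
  surj : ∀ α ∈ J, ∀ z ∈ chains U, d z = 0 →
    ∃ z' ∈ chains (U ∩ {e | α ≤ idx e}), ∃ y ∈ chains U, z = z' + d y
  nonzero : ∃ z ∈ chains (U ∩ {e | deg e = m}), d z = 0 ∧ ∀ y ∈ chains U, d y ≠ z

namespace ConstantHomology

variable {idx : E → W} {deg : E → ℕ} {U : Set E} {J : Set W}
  {d : (E →₀ ℤ) →ₗ[ℤ] (E →₀ ℤ)} {m : ℕ}

theorem map_mem (h : ConstantHomology idx deg U J d m) {x : E →₀ ℤ} (hx : x ∈ chains U) :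
    d x ∈ chains U :=
  map_mem_chains (fun e he => chains_mono (fun _ hx => hx.1) (h.map_single e he)) hx

theorem map_mem_ge (h : ConstantHomology idx deg U J d m) {α : W} {x : E →₀ ℤ}
    (hx : x ∈ chains (U ∩ {e | α ≤ idx e})) : d x ∈ chains (U ∩ {e | α ≤ idx e}) :=
  map_mem_chains (fun e he => by
    refine chains_mono ?_ (h.map_single e he.1)
    exact fun _ hx => ⟨hx.1, le_trans (Set.mem_ofPred.1 he.2) hx.2.1⟩) hx

theorem map_proj_deg (h : ConstantHomology idx deg U J d m) (k : ℕ) {y : E →₀ ℤ}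
    (hy : y ∈ chains U) :
    d (proj {e | deg e = k + 1} y) = proj {e | deg e = k} (d y) := by
  refine map_proj (fun e he => ?_) (fun e he => ?_) hy
  · refine chains_mono (fun x hx => ?_) (h.map_single e he.1)
    have h1 := hx.2.2
    have h2 : deg e = k + 1 := he.2
    simp only [Set.mem_ofPred_eq]
    omega
  · refine chains_mono (fun x hx => ?_) (h.map_single e he.1)
    have h1 := hx.2.2
    have h2 : ¬ deg e = k + 1 := he.2
    simp only [Set.mem_compl_iff, Set.mem_ofPred_eq]
    omega

/-- In the top degree nothing is a boundary, so homologous cycles agree there. Moving `z` above an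
index in its own support therefore leaves it unchanged, which is impossible. -/
theorem false_of_deg_le (h : ConstantHomology idx deg U J d m) (hJ : StrictlyBounded J ℵ₀)
    (hdeg : ∀ e ∈ U, deg e ≤ m) : False := by
  obtain ⟨z, hz, hdz, hnb⟩ := h.nonzero
  have hzU := (mem_chains_inter.1 hz).1
  have hz0 : z ≠ 0 := fun h0 => hnb 0 (zero_mem _) (by rw [map_zero, h0])
  obtain ⟨e, he⟩ := Finsupp.ne_iff.1 hz0
  rw [Finsupp.zero_apply] at he
  have heU := mem_chains_iff.1 hzU e he
  obtain ⟨α, hα, hlt⟩ := hJ {idx e} (Set.singleton_subset_iff.2 (h.idx_mem e heU))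
    (lt_aleph0_of_finite _)
  obtain ⟨z', hz', y, hy, hzy⟩ := h.surj α hα z hzU hdz
  have hy0 : proj {e | deg e = m + 1} y = 0 := by
    refine proj_eq_zero (chains_mono (fun x hx => ?_) hy)
    have := hdeg x hx
    simp only [Set.mem_compl_iff, Set.mem_ofPred_eq]
    omega
  have h1 : proj {e | deg e = m} (d y) = 0 := by
    rw [← h.map_proj_deg m hy, hy0, map_zero]
  have h2 : z = proj {e | deg e = m} z' := by
    rw [← proj_of_mem (mem_chains_inter.1 hz).2, hzy, map_add, h1, add_zero]
  have h3 : z ∈ chains (U ∩ {e | α ≤ idx e}) := h2 ▸ proj_mem_of_mem hz'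
  exact absurd (mem_chains_iff.1 h3 e he).2 (not_le.2 (hlt _ rfl))

/-- Preimages under `d` can be chosen compatibly with the filtration. -/
theorem exists_section (h : ConstantHomology idx deg U J d m) (x : E →₀ ℤ) :
    ∃ y : E →₀ ℤ, (∃ y ∈ chains U, d y = x) → y ∈ chains U ∧ d y = x ∧
      ∀ α ∈ J, x ∈ chains (U ∩ {e | α ≤ idx e}) → y ∈ chains (U ∩ {e | α ≤ idx e}) := by
  by_cases hx : ∃ y ∈ chains U, d y = x
  swap
  · exact ⟨0, fun h => absurd h hx⟩
  by_cases hx0 : x = 0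
  · exact ⟨0, fun _ => ⟨zero_mem _, by rw [map_zero, hx0], fun _ _ _ => zero_mem _⟩⟩
  obtain ⟨y, hy, hyx⟩ := hx
  have hxU : x ∈ chains U := hyx ▸ h.map_mem hy
  -- The least index in the support of `x` is the highest level containing `x`; a preimage at that
  -- level serves every `α` at once.
  obtain ⟨e, he, hmin⟩ := x.support.exists_min_image idx (Finsupp.support_nonempty_iff.2 hx0)
  have hxe : x ∈ chains (U ∩ {f | idx e ≤ idx f}) := mem_chains_iff.2 fun f hf =>
    ⟨mem_chains_iff.1 hxU f hf, hmin f (Finsupp.mem_support_iff.2 hf)⟩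
  obtain ⟨y', hy', hd⟩ := h.inj (idx e) (h.idx_mem e (mem_chains_iff.1 hxU e
    (Finsupp.mem_support_iff.1 he))) y hy (hyx ▸ hxe)
  refine ⟨y', fun _ => ⟨(mem_chains_inter.1 hy').1, hd.trans hyx, fun α _ hα => ?_⟩⟩
  have : α ≤ idx e := (mem_chains_iff.1 hα e (Finsupp.mem_support_iff.1 he)).2
  refine chains_mono ?_ hy'
  exact fun f hf => ⟨hf.1, le_trans this hf.2⟩

/-- The premises stand under the existential so that `choose` gives a total function, under which a
set can be closed. -/
theorem exists_transport (h : ConstantHomology idx deg U J d m) (x : E →₀ ℤ) (e : E) :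
    ∃ z : E →₀ ℤ, x ∈ chains U → d x = 0 → e ∈ U →
      z ∈ chains (U ∩ {f | idx e ≤ idx f}) ∧ ∃ y ∈ chains U, x = z + d y := by
  by_cases hx : x ∈ chains U ∧ d x = 0 ∧ e ∈ U
  · obtain ⟨z, hz, hy⟩ := h.surj (idx e) (h.idx_mem e hx.2.2) x hx.1 hx.2.1
    exact ⟨z, fun _ _ _ => ⟨hz, hy⟩⟩
  · exact ⟨0, fun h1 h2 h3 => absurd ⟨h1, h2, h3⟩ hx⟩

theorem exists_idx_ge (h : ConstantHomology idx deg U J d m) {α : W} (hα : α ∈ J) :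
    ∃ e ∈ U, α ≤ idx e := by
  obtain ⟨z, hz, hdz, hnb⟩ := h.nonzero
  obtain ⟨z', hz', y, hy, hzy⟩ := h.surj α hα z (mem_chains_inter.1 hz).1 hdz
  have hz0 : z' ≠ 0 := fun h0 => hnb y hy (by rw [hzy, h0, zero_add])
  obtain ⟨e, he⟩ := Finsupp.ne_iff.1 hz0
  have := mem_chains_iff.1 hz' e he
  exact ⟨e, this.1, this.2⟩

/-- A Löwenheim–Skolem argument: `S` is closed under the differential, the chosen preimages `φ` and
the chosen transports `ψ`, so the witnesses for constant homology stay inside `S`. The function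
`next` makes the indices of `S` climb, which gives strict bounds below `δ`. -/
theorem exists_closed_part [WellFoundedLT W] (h : ConstantHomology idx deg U J d m)
    {κ : Cardinal.{v}} (hκ : κ.IsRegular) (hJ : StrictlyBounded J (Order.succ κ))
    {z : E →₀ ℤ} (hz : z ∈ chains U) :
    ∃ S ⊆ U, ∃ δ ∈ J, StrictlyBounded {w ∈ J | w < δ} κ ∧ z ∈ chains S ∧
      (∀ e ∈ S, idx e < δ) ∧ (∀ x ∈ chains S, d x ∈ chains S) ∧
      (∀ α ∈ J, ∀ y ∈ chains U, d y ∈ chains (S ∩ {e | α ≤ idx e}) →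
        ∃ s ∈ chains (S ∩ {e | α ≤ idx e}), d s = d y) ∧
      (∀ α ∈ {w ∈ J | w < δ}, ∀ s ∈ chains S, d s = 0 →
        ∃ s' ∈ chains (S ∩ {e | α ≤ idx e}), ∃ y ∈ chains S, s = s' + d y) := by
  choose φ hφ using h.exists_section
  choose ψ hψ using h.exists_transport
  let g : Finset E → Set E := fun A => U ∩ ((z.support : Set E) ∪
    ⋃ x ∈ (chains (A : Set E) : Set (E →₀ ℤ)), ((((d x).support : Set E) ∪ (φ x).support) ∪
      ⋃ e ∈ A, ((ψ x e).support : Set E)))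
  have hg : ∀ A, (g A).Countable := fun A => by
    refine Set.Countable.mono Set.inter_subset_right ((Finset.countable_toSet _).union ?_)
    refine (countable_chains A).biUnion fun x _ =>
      ((Finset.countable_toSet _).union (Finset.countable_toSet _)).union ?_
    exact (Finset.countable_toSet A).biUnion fun e _ => Finset.countable_toSet _
  have hnext : ∀ T : Set E, ∃ u ∈ U, T ⊆ U → #T ≤ κ → ∀ t ∈ T, idx t < idx u := by
    intro T
    by_cases hT : T ⊆ U ∧ #T ≤ κ
    · obtain ⟨w, hw, hlt⟩ := hJ (idx '' T)
        (by rintro _ ⟨t, ht, rfl⟩; exact h.idx_mem t (hT.1 ht))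
        (mk_image_le.trans_lt (Order.lt_succ_of_le hT.2))
      obtain ⟨u, hu, hwu⟩ := h.exists_idx_ge hw
      exact ⟨u, hu, fun _ _ t ht => (hlt _ ⟨t, ht, rfl⟩).trans_le hwu⟩
    · obtain ⟨w, hw, -⟩ := hJ ∅ (Set.empty_subset _) (by simp)
      obtain ⟨u, hu, -⟩ := h.exists_idx_ge hw
      exact ⟨u, hu, fun h1 h2 => absurd ⟨h1, h2⟩ hT⟩
  choose next hnU hnlt using hnext
  obtain ⟨S, hSU, hSc, hcl, hcof⟩ := exists_closed_chain hκ U g hg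
    (fun A => Set.inter_subset_left) next hnU
  have hSUc := chains_mono hSU
  have hcl' : ∀ x ∈ chains S, ((d x).support : Set E) ∩ U ⊆ S ∧
      ((φ x).support : Set E) ∩ U ⊆ S ∧ ∀ e ∈ S, ((ψ x e).support : Set E) ∩ U ⊆ S := by
    classical
    intro x hx
    have hA : (x.support : Set E) ⊆ S := (mem_supported ℤ x).1 hx
    have hxA : x ∈ chains (x.support : Set E) := mem_supported_support ℤ x
    refine ⟨fun f hf => hcl _ hA ⟨hf.2, Or.inr (Set.mem_biUnion hxA (Or.inl (Or.inl hf.1)))⟩,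
      fun f hf => hcl _ hA ⟨hf.2, Or.inr (Set.mem_biUnion hxA (Or.inl (Or.inr hf.1)))⟩,
      fun e he f hf => ?_⟩
    have hA' : ((insert e x.support : Finset E) : Set E) ⊆ S := by
      rw [Finset.coe_insert]
      exact Set.insert_subset he hA
    have hxA' : x ∈ chains ((insert e x.support : Finset E) : Set E) :=
      chains_mono (by rw [Finset.coe_insert]; exact Set.subset_insert _ _) hxA
    exact hcl _ hA' ⟨hf.2, Or.inr (Set.mem_biUnion hxA'
      (Or.inr (Set.mem_biUnion (Finset.mem_insert_self _ _) hf.1)))⟩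
  have hmemS : ∀ {x : E →₀ ℤ}, (x.support : Set E) ∩ U ⊆ S → x ∈ chains U → x ∈ chains S :=
    fun hs hx => mem_chains_iff.2 fun e he =>
      hs ⟨Finsupp.mem_support_iff.2 he, mem_chains_iff.1 hx e he⟩
  obtain ⟨b, hb, hbS⟩ := hJ (idx '' S)
    (by rintro _ ⟨t, ht, rfl⟩; exact h.idx_mem t (hSU ht))
    (mk_image_le.trans_lt (Order.lt_succ_of_le hSc))
  -- Leastness of `δ` makes the indices of `S` cofinal among the elements of `J` below `δ`.
  obtain ⟨δ, ⟨hδJ, hδ⟩, hmin⟩ := wellFounded_lt.has_min {w | w ∈ J ∧ ∀ e ∈ S, idx e < w}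
    ⟨b, hb, fun e he => hbS _ ⟨e, he, rfl⟩⟩
  have hcofS : ∀ α ∈ {w ∈ J | w < δ}, ∃ e ∈ S, α ≤ idx e := by
    intro α hα
    by_contra! hcon
    exact hmin α ⟨hα.1, hcon⟩ hα.2
  refine ⟨S, hSU, δ, hδJ, ?_, ?_, hδ, ?_, ?_, ?_⟩
  · intro X hX hXc
    have hc : ∀ x : X, ∃ e ∈ S, x.1 ≤ idx e := fun x => hcofS x.1 (hX x.2)
    choose f hfS hf using hc
    obtain ⟨T, hXT, hTU, hTc, hTS⟩ := hcof (Set.range f)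
      (by rintro _ ⟨x, rfl⟩; exact hfS x) (mk_range_le.trans_lt hXc)
    refine ⟨idx (next T), ⟨h.idx_mem _ (hnU T), hδ _ hTS⟩, fun x hx => ?_⟩
    exact (hf ⟨x, hx⟩).trans_lt (hnlt T hTU hTc _ (hXT ⟨⟨x, hx⟩, rfl⟩))
  · refine mem_chains_iff.2 fun e he => hcl ∅ (by simp) ⟨mem_chains_iff.1 hz e he, Or.inl ?_⟩
    exact Finsupp.mem_support_iff.2 he
  · intro x hx
    exact hmemS (hcl' x hx).1 (h.map_mem (hSUc hx))
  · intro α hα y hy hdy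
    obtain ⟨h1, h2, h3⟩ := hφ (d y) ⟨y, hy, rfl⟩
    have hdS := mem_chains_inter.1 hdy
    refine ⟨φ (d y), mem_chains_inter.2 ⟨hmemS (hcl' _ hdS.1).2.1 h1, ?_⟩, h2⟩
    exact (mem_chains_inter.1 (h3 α hα (mem_chains_inter.2 ⟨hSUc hdS.1, hdS.2⟩))).2
  · intro α hα s hs hds
    obtain ⟨e, he, hαe⟩ := hcofS α hα
    obtain ⟨h1, y, hy, hsy⟩ := hψ s e (hSUc hs) hds (hSU he)
    have hψS : ψ s e ∈ chains S := hmemS ((hcl' s hs).2.2 e he) (mem_chains_inter.1 h1).1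
    have hdy : d y = s - ψ s e := (sub_eq_of_eq_add' hsy).symm
    have hdyS : d y ∈ chains S := hdy ▸ sub_mem hs hψS
    obtain ⟨h3, h4, -⟩ := hφ (d y) ⟨y, hy, rfl⟩
    refine ⟨ψ s e, mem_chains_inter.2 ⟨hψS, ?_⟩, φ (d y), hmemS (hcl' _ hdyS).2.1 h3, ?_⟩
    · exact chains_mono (fun f hf => le_trans hαe hf) (mem_chains_inter.1 h1).2
    · rw [h4]
      exact hsy

/-- Dividing out a closed part `S` below `δ` and the part above `δ`, both of which have the same
homology as the whole complex, shifts this homology up by one degree. -/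
theorem quotient (h : ConstantHomology idx deg U J d m) {S : Set E} (hSU : S ⊆ U) {δ : W}
    (hδ : δ ∈ J) {z : E →₀ ℤ} (hz : z ∈ chains (U ∩ {e | deg e = m})) (hdz : d z = 0)
    (hnb : ∀ y ∈ chains U, d y ≠ z) (hzS : z ∈ chains S) (hSδ : ∀ e ∈ S, idx e < δ)
    (hdS : ∀ x ∈ chains S, d x ∈ chains S)
    (hinj : ∀ α ∈ J, ∀ y ∈ chains U, d y ∈ chains (S ∩ {e | α ≤ idx e}) →
      ∃ s ∈ chains (S ∩ {e | α ≤ idx e}), d s = d y)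
    (hsurj : ∀ α ∈ {w ∈ J | w < δ}, ∀ s ∈ chains S, d s = 0 →
      ∃ s' ∈ chains (S ∩ {e | α ≤ idx e}), ∃ y ∈ chains S, s = s' + d y) :
    ConstantHomology idx deg (U \ (S ∪ (U ∩ {e | δ ≤ idx e}))) {w ∈ J | w < δ}
      (proj (U \ (S ∪ (U ∩ {e | δ ≤ idx e}))) ∘ₗ d) (m + 1) := by
  -- The quotient by the chains on `S ∪ D` is modelled on the remaining basis `U'`, with
  -- differential `proj U' ∘ d`.
  set D := U ∩ {e | δ ≤ idx e} with hD
  set U' := U \ (S ∪ D) with hU'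
  have hDU : D ⊆ U := Set.inter_subset_left
  have hU'U : U' ⊆ U := Set.sdiff_subset
  have hdD : ∀ {x}, x ∈ chains D → d x ∈ chains D := fun hx => h.map_mem_ge hx
  have hdisj : Disjoint S D := Set.disjoint_left.2 fun e he hD => (hSδ e he).not_ge hD.2
  have hSc := chains_mono hSU
  have hDc := chains_mono hDU
  have hUc := chains_mono hU'U
  have hSR : chains S ≤ chains (S ∪ D) := chains_mono Set.subset_union_left
  have hDR : chains D ≤ chains (S ∪ D) := chains_mono Set.subset_union_right
  have hdR : ∀ {x}, x ∈ chains (S ∪ D) → d x ∈ chains (S ∪ D) := fun hx => by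
    obtain ⟨s, hs, t, ht, rfl⟩ := exists_add_of_mem_chains_union hx
    rw [map_add]
    exact add_mem (hSR (hdS s hs)) (hDR (hdD ht))
  have hpR : ∀ {x}, x ∈ chains (S ∪ D) → proj U' x = 0 := fun hx =>
    proj_eq_zero (chains_mono (fun e he h => h.2 he) hx)
  have hpd : ∀ {x}, x ∈ chains U → x - proj U' x ∈ chains (S ∪ D) := fun hx => by
    refine chains_mono (fun e he => ?_) (sub_proj_mem (U := U') hx)
    by_contra h'
    exact he.2 ⟨he.1, h'⟩
  have hpdp : ∀ {x}, x ∈ chains U → proj U' (d (proj U' x)) = proj U' (d x) := fun {x} hx => by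
    have := hpR (hdR (hpd hx))
    rw [map_sub, map_sub, sub_eq_zero] at this
    exact this.symm
  have hdec : ∀ {x}, x ∈ chains U → ∃ s ∈ chains S, ∃ t ∈ chains D, x = proj U' x + (s + t) :=
    fun {x} hx => by
      obtain ⟨s, hs, t, ht, e⟩ := exists_add_of_mem_chains_union (hpd hx)
      exact ⟨s, hs, t, ht, by rw [← e]; abel⟩
  have hDge : ∀ {α}, α < δ → chains D ≤ chains (U ∩ {e | α ≤ idx e}) := fun {α} hα => by
    refine chains_mono ?_
    exact fun e he => ⟨he.1, hα.le.trans he.2⟩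
  have hSge : ∀ {α : W} {x : E →₀ ℤ}, x ∈ chains (S ∩ {e | α ≤ idx e}) →
      x ∈ chains (U ∩ {e | α ≤ idx e}) :=
    fun hx => chains_mono (Set.inter_subset_inter_left _ hSU) hx
  have hge : ∀ {α} {x}, x ∈ chains (U ∩ {e | α ≤ idx e}) →
      proj U' x ∈ chains (U' ∩ {e | α ≤ idx e}) := fun {α x} hx =>
    mem_chains_inter.2 ⟨proj_mem x, proj_mem_of_mem (mem_chains_inter.1 hx).2⟩
  refine ⟨?_, ?_, ?_, ?_, ?_, ?_⟩
  · intro e he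
    have h1 := h.map_single e (hU'U he)
    have h2 := mem_chains_inter.2 ⟨proj_mem (U := U') _, proj_mem_of_mem (U := U') h1⟩
    refine chains_mono ?_ h2
    exact fun x hx => ⟨hx.1, hx.2.2⟩
  · intro x hx
    rw [LinearMap.comp_apply, LinearMap.comp_apply, hpdp (h.map_mem (hUc hx)), h.sq x (hUc hx),
      map_zero]
  · intro e he
    refine ⟨h.idx_mem e he.1, ?_⟩
    by_contra h'
    exact he.2 (Or.inr ⟨he.1, not_lt.1 h'⟩)
  -- Write `d y = q + s + t`. The `S`-part `s` is replaced by `s'` at level `α` with the same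
  -- boundary; the cycle `s - s'` is homologous to some `t₁` on `D`. All of `q + s' + t + t₁` then
  -- lies at level `α` and bounds, so it bounds there.
  · rintro α ⟨hαJ, hαδ⟩ y hy hq
    rw [LinearMap.comp_apply] at hq ⊢
    have hyU := hUc hy
    obtain ⟨s, hs, t, ht, e⟩ := hdec (h.map_mem hyU)
    set q := proj U' (d y) with hqdef
    have hqU : q ∈ chains (U ∩ {e | α ≤ idx e}) :=
      chains_mono (Set.inter_subset_inter_left _ hU'U) hq
    have hds : d s = -(d q + d t) := by
      have := congrArg d e
      rw [h.sq y hyU, map_add, map_add] at this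
      rw [eq_neg_iff_add_eq_zero, this]
      abel
    have hdsα : d s ∈ chains (S ∩ {e | α ≤ idx e}) := by
      refine mem_chains_inter.2 ⟨hdS s hs, ?_⟩
      rw [hds]
      exact neg_mem (mem_chains_inter.1
        (add_mem (h.map_mem_ge hqU) (hDge hαδ (hdD ht)))).2
    obtain ⟨s', hs', e'⟩ := hinj α hαJ s (hSc hs) hdsα
    have hs'S := (mem_chains_inter.1 hs').1
    obtain ⟨t₁, ht₁, y₁, hy₁, e₁⟩ := h.surj δ hδ (s - s') (hSc (sub_mem hs hs'S))
      (by rw [map_sub, e', sub_self])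
    have hcyc : q + s' + t + t₁ = d (y - y₁) := by
      rw [map_sub, e]
      have : t₁ = s - s' - d y₁ := (sub_eq_of_eq_add e₁).symm
      rw [this]
      abel
    obtain ⟨y₂, hy₂, e₂⟩ := h.inj α hαJ (y - y₁) (sub_mem hyU hy₁) (by
      rw [← hcyc]
      exact add_mem (add_mem (add_mem hqU (hSge hs')) (hDge hαδ ht)) (hDge hαδ ht₁))
    refine ⟨proj U' y₂, hge hy₂, ?_⟩
    rw [LinearMap.comp_apply, hpdp (mem_chains_inter.1 hy₂).1, e₂, ← hcyc, map_add, map_add,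
      map_add, hpR (hSR hs'S), hpR (hDR ht), hpR (hDR ht₁), proj_of_mem (proj_mem _)]
    abel
  -- Here `d x = s + t`, and disjointness of `S` and `D` makes `s` a cycle. Moving `s` to level `α`
  -- inside `S` lets `d (x - y)` be filled by some `q` at that level; the cycle `x - y - q` is
  -- homologous to one on `D`, which dies in the quotient.
  · rintro α ⟨hαJ, hαδ⟩ x hx hdx
    rw [LinearMap.comp_apply] at hdx
    have hxU := hUc hx
    obtain ⟨s, hs, t, ht, e⟩ := hdec (h.map_mem hxU)
    rw [hdx, zero_add] at e
    have hds : d s = 0 := by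
      have := congrArg d e
      rw [h.sq x hxU, map_add] at this
      refine eq_zero_of_mem_chains (hdS s hs) ?_ hdisj
      rw [eq_neg_of_add_eq_zero_left this.symm]
      exact neg_mem (hdD ht)
    obtain ⟨s', hs', y, hy, e'⟩ := hsurj α ⟨hαJ, hαδ⟩ s hs hds
    have hc : d (x - y) = s' + t := by
      rw [map_sub, e, e']
      abel
    obtain ⟨q, hq, eq⟩ := h.inj α hαJ (x - y) (sub_mem hxU (hSc hy)) (by
      rw [hc]
      exact add_mem (hSge hs') (hDge hαδ ht))
    have hqU := (mem_chains_inter.1 hq).1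
    obtain ⟨t', ht', y', hy', e₂⟩ := h.surj δ hδ (x - y - q)
      (sub_mem (sub_mem hxU (hSc hy)) hqU) (by rw [map_sub, eq, sub_self])
    refine ⟨proj U' q, hge hq, proj U' y', proj_mem _, ?_⟩
    rw [LinearMap.comp_apply, hpdp hy']
    have := congrArg (proj U') e₂
    rw [map_sub, map_sub, map_add, hpR (hSR hy), hpR (hDR ht'), proj_of_mem hx] at this
    rw [sub_zero, zero_add] at this
    rw [← this]
    abel
  -- The class `z` has representatives both on `S` and on `D`. The chain `y₀` joining them is the
  -- new cycle, one degree higher.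
  · obtain ⟨t, ht, y, hy, e⟩ := h.surj δ hδ z (hSc hzS) hdz
    have ht' := proj_mem_of_mem (U := {e | deg e = m}) ht
    have hym : d (proj {e | deg e = m + 1} y) = z - proj {e | deg e = m} t := by
      rw [h.map_proj_deg m hy, ← sub_eq_of_eq_add' e, map_sub,
        proj_of_mem (mem_chains_inter.1 hz).2]
    set t₀ := proj {e | deg e = m} t
    set y₀ := proj {e | deg e = m + 1} y
    have hy₀ : y₀ ∈ chains U := proj_mem_of_mem hy
    refine ⟨proj U' y₀, mem_chains_inter.2 ⟨proj_mem _, proj_mem_of_mem (proj_mem _)⟩, ?_, ?_⟩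
    · rw [LinearMap.comp_apply, hpdp hy₀, hym, map_sub, hpR (hSR hzS), hpR (hDR ht'), sub_zero]
    · intro w hw hwe
      rw [LinearMap.comp_apply] at hwe
      have hr : d w - y₀ ∈ chains (S ∪ D) := by
        have := sub_mem (hpd (h.map_mem (hUc hw))) (hpd hy₀)
        rwa [hwe, sub_sub_sub_cancel_right] at this
      obtain ⟨s, hs, r, hr', e'⟩ := exists_add_of_mem_chains_union hr
      have h1 := congrArg d e'
      rw [map_sub, h.sq w (hUc hw), hym, map_add, zero_sub, neg_sub] at h1
      have h2 : z + d s = t₀ - d r := by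
        rw [sub_eq_iff_eq_add] at h1
        rw [h1]
        abel
      -- The two sides of `h2` are supported on `S` and on `D`, so both vanish; then `z` bounds
      -- `-s`, contrary to the choice of `z`.
      have h3 : z + d s = 0 := eq_zero_of_mem_chains (add_mem hzS (hdS s hs))
        (h2 ▸ sub_mem ht' (hdD hr')) hdisj
      refine hnb (-s) (hSc (neg_mem hs)) ?_
      rw [map_neg, ← eq_neg_of_add_eq_zero_left h3]

/-- Each passage to the quotient raises `m` and lowers `n` by one, so the degree bound `m + n`
survives. -/
theorem false_of_strictlyBounded [WellFoundedLT W] (n : ℕ) :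
    ∀ {m : ℕ} {U : Set E} {J : Set W} {d : (E →₀ ℤ) →ₗ[ℤ] (E →₀ ℤ)},
      ConstantHomology idx deg U J d m → StrictlyBounded J (ℵ_ (n : Ordinal.{v})) →
      (∀ e ∈ U, deg e ≤ m + n) → False := by
  induction n with
  | zero =>
    intro m U J d h hJ hdeg
    exact h.false_of_deg_le (by simpa using hJ) hdeg
  | succ n ih =>
    intro m U J d h hJ hdeg
    obtain ⟨z, hz, hdz, hnb⟩ := h.nonzero
    have hJ' : StrictlyBounded J (Order.succ (ℵ_ (n : Ordinal.{v}))) := by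
      rw [succ_aleph]
      exact_mod_cast hJ
    obtain ⟨S, hSU, δ, hδ, hb, hzS, hSδ, hdS, hinj, hsurj⟩ :=
      h.exists_closed_part (isRegular_aleph_natCast n) hJ' (mem_chains_inter.1 hz).1
    refine ih (h.quotient hSU hδ hz hdz hnb hzS hSδ hdS hinj hsurj) hb fun e he => ?_
    have := hdeg e he.1
    omega

end ConstantHomology

end ConstantHomology

/-! ### The augmented chain complex of the full simplex. -/

section Total

variable {V : Type*}

/-- The inclusion of the `k`-chains of `K` in the total complex. -/
noncomputable def chainInclusion (K : PreAbstractSimplicialComplex V) (k : ℕ) :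
    Chain K k →ₗ[ℤ] (Finset V →₀ ℤ) :=
  lmapDomain ℤ ℤ Subtype.val

theorem chainInclusion_injective (K : PreAbstractSimplicialComplex V) (k : ℕ) :
    Function.Injective (chainInclusion K k) :=
  mapDomain_injective Subtype.val_injective

theorem mem_chains_kFaces_iff {K : PreAbstractSimplicialComplex V} {k : ℕ}
    {z : Finset V →₀ ℤ} : z ∈ chains (kFaces K k) ↔ ∃ x, chainInclusion K k x = z := by
  have h := lmapDomain_supported (M := ℤ) (R := ℤ) (Subtype.val : kFaces K k → Finset V) Set.univ
  rw [supported_univ, Set.image_univ, Subtype.range_coe] at h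
  rw [chains, ← h]
  simp [chainInclusion]

variable [LinearOrder V]

/-- The boundary map of the augmented chain complex of the full simplex on `V`, in all degrees at
once; the empty set spans the part of degree `-1`. -/
noncomputable def totalBoundary (V : Type*) [LinearOrder V] :
    (Finset V →₀ ℤ) →ₗ[ℤ] (Finset V →₀ ℤ) :=
  linearCombination ℤ fun s => ∑ v ∈ s, single (s.erase v) ((-1 : ℤ) ^ position s v)

theorem totalBoundary_single (s : Finset V) :
    totalBoundary V (single s 1) = ∑ v ∈ s, single (s.erase v) ((-1 : ℤ) ^ position s v) := by
  simp [totalBoundary]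

theorem totalBoundary_single_mem {s : Finset V} {X : Set (Finset V)}
    (h : ∀ v ∈ s, s.erase v ∈ X) : totalBoundary V (single s 1) ∈ chains X := by
  rw [totalBoundary_single]
  exact sum_mem fun v hv => single_mem_supported ℤ _ (h v hv)

/-- The cone with apex `b`, with sign. -/
noncomputable def cone (b : V) : (Finset V →₀ ℤ) →ₗ[ℤ] (Finset V →₀ ℤ) :=
  linearCombination ℤ fun s => if b ∈ s then 0 else single (insert b s) ((-1 : ℤ) ^ position s b)

theorem cone_single_of_mem {b : V} {s : Finset V} (h : b ∈ s) (a : ℤ) :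
    cone b (single s a) = 0 := by
  simp [cone, h]

theorem cone_single_of_notMem {b : V} {s : Finset V} (h : b ∉ s) (a : ℤ) :
    cone b (single s a) = single (insert b s) (a * (-1 : ℤ) ^ position s b) := by
  simp [cone, h]

theorem neg_one_pow_mul_self (k : ℕ) : (-1 : ℤ) ^ k * (-1) ^ k = 1 := by
  rw [← mul_pow]
  simp

/-- The cone is a contracting homotopy of the augmented simplex; this identity drives every later
acyclicity argument. -/
theorem totalBoundary_cone_add (b : V) (x : Finset V →₀ ℤ) :
    totalBoundary V (cone b x) + cone b (totalBoundary V x) = x := by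
  suffices h : totalBoundary V ∘ₗ cone b + cone b ∘ₗ totalBoundary V = LinearMap.id from
    LinearMap.congr_fun h x
  refine Finsupp.lhom_ext' fun s => LinearMap.ext_ring ?_
  simp only [LinearMap.comp_apply, LinearMap.add_apply, lsingle_apply, LinearMap.id_apply]
  rw [totalBoundary_single, map_sum]
  by_cases hb : b ∈ s
  · rw [cone_single_of_mem hb, map_zero, zero_add, Finset.sum_eq_single_of_mem b hb]
    · rw [cone_single_of_notMem (Finset.notMem_erase b s), Finset.insert_erase hb,
        position_erase_of_not_lt s b b (lt_irrefl b), neg_one_pow_mul_self]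
    · intro v _ hv
      exact cone_single_of_mem (Finset.mem_erase.2 ⟨hv.symm, hb⟩) _
  · have herase : (insert b s).erase b = s := Finset.erase_insert hb
    have hpos : position (insert b s) b = position s b := by
      rw [← position_erase_of_not_lt (insert b s) b b (lt_irrefl b), herase]
    rw [cone_single_of_notMem hb, one_mul, ← mul_one ((-1 : ℤ) ^ position s b),
      ← smul_eq_mul, ← smul_single, map_smul, totalBoundary_single, Finset.sum_insert hb, herase,
      smul_add, smul_single, hpos, smul_eq_mul, neg_one_pow_mul_self, Finset.smul_sum, add_assoc,
      ← Finset.sum_add_distrib, Finset.sum_eq_zero, add_zero]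
    intro v hv
    have hvb : v ≠ b := fun h => hb (h ▸ hv)
    have hb' : b ∉ s.erase v := fun h => hb (Finset.mem_of_mem_erase h)
    have hc := sign_cancel (insert b s) b v (Finset.mem_insert_self b s)
      (Finset.mem_insert_of_mem hv) hvb.symm
    rw [herase, hpos] at hc
    rw [cone_single_of_notMem hb', smul_single, Finset.erase_insert_of_ne hvb.symm, ← single_add]
    have hpos' : position ((insert b s).erase v) b = position (s.erase v) b := by
      rw [← position_erase_of_not_lt ((insert b s).erase v) b b (lt_irrefl b),
        Finset.erase_insert_of_ne hvb.symm, Finset.erase_insert hb']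
    rw [hpos'] at hc
    have h1 := neg_one_pow_mul_self (position s v)
    have h2 := neg_one_pow_mul_self (position (insert b s) v)
    rw [single_eq_zero, smul_eq_mul]
    linear_combination (-1 : ℤ) ^ position s v * (-1) ^ position (insert b s) v * hc -
      (-1 : ℤ) ^ position s b * (-1) ^ position (insert b s) v * h1 -
      (-1 : ℤ) ^ position s v * (-1) ^ position (s.erase v) b * h2

/-- Induction on the simplex: a nonempty simplex is, up to sign, a cone over a smaller one, and the
homotopy formula reduces the claim to the base. -/
theorem totalBoundary_totalBoundary (x : Finset V →₀ ℤ) :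
    totalBoundary V (totalBoundary V x) = 0 := by
  suffices h : ∀ s : Finset V, totalBoundary V (totalBoundary V (single s 1)) = 0 by
    have h' : totalBoundary V ∘ₗ totalBoundary V = 0 :=
      Finsupp.lhom_ext' fun s => LinearMap.ext_ring (h s)
    exact LinearMap.congr_fun h' x
  intro s
  induction s using Finset.induction_on with
  | empty => simp [totalBoundary_single]
  | insert b s hb ih =>
    have h1 : single (insert b s) (1 : ℤ) =
        ((-1 : ℤ) ^ position s b) • cone b (single s 1) := by
      rw [cone_single_of_notMem hb, smul_single, one_mul, smul_eq_mul, neg_one_pow_mul_self]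
    have h2 := totalBoundary_cone_add b (single s 1)
    have h3 := totalBoundary_cone_add b (totalBoundary V (single s 1))
    rw [ih, map_zero, add_zero] at h3
    rw [h1, map_smul, map_smul, eq_sub_of_add_eq h2, map_sub, h3, sub_self, smul_zero]

theorem totalBoundary_chainInclusion (K : PreAbstractSimplicialComplex V) (k : ℕ)
    (x : Chain K (k + 1)) :
    totalBoundary V (chainInclusion K (k + 1) x) = chainInclusion K k (boundary K k x) := by
  suffices h : totalBoundary V ∘ₗ chainInclusion K (k + 1) = chainInclusion K k ∘ₗ boundary K k from
    LinearMap.congr_fun h x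
  refine Finsupp.lhom_ext' fun s => LinearMap.ext_ring ?_
  simp only [LinearMap.comp_apply, lsingle_apply, boundary, linearCombination_single, one_smul,
    map_sum, chainInclusion, lmapDomain_apply, mapDomain_single, totalBoundary_single, eraseVertex]
  exact (Finset.sum_coe_sort s.1
    fun v => single (s.1.erase v) ((-1 : ℤ) ^ position s.1 v)).symm

theorem totalBoundary_chainInclusion_zero (K : PreAbstractSimplicialComplex V) (x : Chain K 0) :
    totalBoundary V (chainInclusion K 0 x) = single ∅ (augmentation K x) := by
  suffices h : totalBoundary V ∘ₗ chainInclusion K 0 = lsingle ∅ ∘ₗ augmentation K from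
    LinearMap.congr_fun h x
  refine Finsupp.lhom_ext' fun s => LinearMap.ext_ring ?_
  obtain ⟨v, hv⟩ := Finset.card_eq_one.1 s.2.2
  simp [chainInclusion, augmentation, totalBoundary_single, hv, position, Finset.filter_singleton]

theorem mem_reducedCycles_iff {K : PreAbstractSimplicialComplex V} {k : ℕ} {x : Chain K k} :
    x ∈ reducedCycles K k ↔ totalBoundary V (chainInclusion K k x) = 0 := by
  cases k with
  | zero =>
    rw [totalBoundary_chainInclusion_zero, single_eq_zero]
    rfl
  | succ k =>
    rw [totalBoundary_chainInclusion, map_eq_zero_iff _ (chainInclusion_injective K k)]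
    rfl

theorem subsingleton_reducedHomology_iff {K : PreAbstractSimplicialComplex V} {k : ℕ} :
    Subsingleton (ReducedHomology K k) ↔ ∀ z ∈ chains (kFaces K k), totalBoundary V z = 0 →
      ∃ w ∈ chains (kFaces K (k + 1)), totalBoundary V w = z := by
  rw [ReducedHomology, Submodule.Quotient.subsingleton_iff, Submodule.submoduleOf,
    Submodule.comap_subtype_eq_top]
  constructor
  · intro h z hz hdz
    obtain ⟨x, rfl⟩ := mem_chains_kFaces_iff.1 hz
    obtain ⟨y, rfl⟩ := h (mem_reducedCycles_iff.2 hdz)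
    exact ⟨_, mem_chains_kFaces_iff.2 ⟨y, rfl⟩, totalBoundary_chainInclusion K k y⟩
  · intro h x hx
    obtain ⟨w, hw, e⟩ := h _ (mem_chains_kFaces_iff.2 ⟨x, rfl⟩) (mem_reducedCycles_iff.1 hx)
    obtain ⟨y, rfl⟩ := mem_chains_kFaces_iff.1 hw
    rw [totalBoundary_chainInclusion] at e
    exact ⟨y, chainInclusion_injective K k e⟩

end Total

/-! ### Acyclic families of top-dimensional faces. -/

section Families

variable {V : Type*} [LinearOrder V]

/-- Every cycle supported on `X` bounds a chain supported on `X`. -/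
def IsAcyclicOn (X : Set (Finset V)) : Prop :=
  ∀ z ∈ chains X, totalBoundary V z = 0 → ∃ w ∈ chains X, totalBoundary V w = z

theorem cone_mem_chains {X Y : Set (Finset V)} {b : V}
    (h : ∀ s ∈ X, b ∉ s → insert b s ∈ Y) {x : Finset V →₀ ℤ} (hx : x ∈ chains X) :
    cone b x ∈ chains Y := by
  refine map_mem_chains (fun s hs => ?_) hx
  by_cases hb : b ∈ s
  · rw [cone_single_of_mem hb]
    exact zero_mem _
  · rw [cone_single_of_notMem hb]
    exact single_mem_supported ℤ _ (h s hs hb)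

theorem totalBoundary_cone_of_cycle (b : V) {z : Finset V →₀ ℤ} (hz : totalBoundary V z = 0) :
    totalBoundary V (cone b z) = z := by
  have := totalBoundary_cone_add b z
  rwa [hz, map_zero, add_zero] at this

theorem exists_le_mem_chains {I : Type*} [LinearOrder I] (f : V → I) {X : Set (Finset V)}
    {Y : Set V} (hY : Y.Nonempty) {z : Finset V →₀ ℤ} (hz : z ∈ chains (X ∩ {s | ↑s ⊆ Y})) :
    ∃ b ∈ Y, z ∈ chains {s ∈ X | ∀ v ∈ s, f v ≤ f b} := by
  classical
  rw [mem_chains_iff] at hz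
  have hF : ∀ v ∈ z.support.biUnion id, v ∈ Y := by
    intro v hv
    obtain ⟨s, hs, hvs⟩ := Finset.mem_biUnion.1 hv
    exact (hz s (Finsupp.mem_support_iff.1 hs)).2 hvs
  have key : ∃ b ∈ Y, ∀ v ∈ z.support.biUnion id, f v ≤ f b := by
    by_cases hn : (z.support.biUnion id).Nonempty
    · obtain ⟨b, hb, h⟩ := Finset.exists_max_image _ f hn
      exact ⟨b, hF b hb, h⟩
    · obtain ⟨b, hb⟩ := hY
      exact ⟨b, hb, fun v hv => absurd ⟨v, hv⟩ hn⟩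
  obtain ⟨b, hb, h⟩ := key
  exact ⟨b, hb, mem_chains_iff.2 fun s hs => ⟨(hz s hs).1, fun v hv =>
    h v (Finset.mem_biUnion.2 ⟨s, Finsupp.mem_support_iff.2 hs, hv⟩)⟩⟩

/-- The complex on `W` with complete `(n - 1)`-skeleton and `n`-faces in `B`, restricted
to `A`; the empty face is included. -/
def skeletonWith (n : ℕ) (W : Set V) (B : Set (Finset V)) (A : Set V) : Set (Finset V) :=
  {s | (s : Set V) ⊆ W ∩ A ∧ (s.card ≤ n ∨ s ∈ B)}

/-- The family of all `insert b s` for `s` in the family that belongs to the vertex `b`. -/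
def insertFamily {I : Type*} (f : V → I) (W : Set V) (B : I → Set (Finset V)) :
    Set (Finset V) :=
  {s | ∃ b ∈ W, ∃ t ∈ B (f b), s = insert b t}

/-- Induction on the `f`-largest vertex `b` of a cycle: the faces through `b` are removed by adding
the boundary of a cone with apex `b`. The set `A` need not be related to the order given by `f`. -/
theorem isAcyclicOn_insertFamily {I : Type*} [LinearOrder I] [WellFoundedLT I] {n : ℕ}
    {W A : Set V} {f : V → I} (hf : Set.InjOn f W) {B : I → Set (Finset V)}
    (hB : ∀ i, ∀ s ∈ B i, s.card = n + 1 ∧ (s : Set V) ⊆ {w ∈ W | f w < i})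
    (hac : ∀ i, ({w ∈ W | f w < i} ∩ A).Nonempty →
      IsAcyclicOn (skeletonWith n {w ∈ W | f w < i} (B i) A))
    (hA : (W ∩ A).Nonempty) :
    IsAcyclicOn (skeletonWith (n + 1) W (insertFamily f W B) A) := by
  set X := skeletonWith (n + 1) W (insertFamily f W B) A
  have key : ∀ i, ∀ b ∈ W ∩ A, f b = i → ∀ z ∈ chains {s ∈ X | ∀ v ∈ s, f v ≤ f b},
      totalBoundary V z = 0 → ∃ w ∈ chains X, totalBoundary V w = z := by
    intro i
    induction i using WellFoundedLT.induction with
    | ind i ih =>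
    rintro b ⟨hbW, hbA⟩ rfl z hz hdz
    have hlt : ∀ {s}, s ∈ {s ∈ X | ∀ v ∈ s, f v ≤ f b} → ∀ v ∈ s, v ≠ b →
        v ∈ {w ∈ W | f w < f b} ∩ A := fun {s} hs v hv hvb => by
      have hvW := hs.1.1 hv
      exact ⟨⟨hvW.1, lt_of_le_of_ne (hs.2 v hv) fun h => hvb (hf hvW.1 hbW h)⟩, hvW.2⟩
    -- With no earlier vertex in `A`, the hypothesis `hac` does not apply; only `∅` and `{b}` can
    -- occur, and the cone with apex `b` settles the case.
    by_cases hY : ({w ∈ W | f w < f b} ∩ A).Nonempty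
    swap
    · refine ⟨cone b z, cone_mem_chains (fun s hs hb => ?_) hz, totalBoundary_cone_of_cycle b hdz⟩
      have hs0 : s = ∅ := Finset.eq_empty_of_forall_notMem fun v hv =>
        hY ⟨v, hlt hs v hv fun h => hb (h ▸ hv)⟩
      subst hs0
      exact ⟨by simp [hbW, hbA], Or.inl (by simp)⟩
    set z₁ := proj {s | b ∈ s} z
    have hz₂ : z - z₁ ∈ chains ({s ∈ X | ∀ v ∈ s, f v ≤ f b} \ {s | b ∈ s}) := sub_proj_mem hz
    have hdz₁ : totalBoundary V z₁ = -totalBoundary V (z - z₁) := by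
      rw [map_sub, hdz, zero_sub, neg_neg]
    -- The faces through `b` cancel in `totalBoundary V z₁`, since it is also minus the boundary of
    -- the part avoiding `b`. What remains lies in the link of `b`.
    have hx : totalBoundary V z₁ ∈ chains (skeletonWith n {w ∈ W | f w < f b} (B (f b)) A) := by
      have h1 : totalBoundary V z₁ ∈ chains {s | b ∉ s} := by
        rw [hdz₁]
        refine neg_mem (map_mem_chains (fun s hs => totalBoundary_single_mem fun v _ hb => ?_) hz₂)
        exact hs.2 (Finset.mem_of_mem_erase hb)
      have h2 : totalBoundary V z₁ ∈ chains
          {s | b ∈ s ∨ s ∈ skeletonWith n {w ∈ W | f w < f b} (B (f b)) A} := by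
        refine map_mem_chains (fun s hs => totalBoundary_single_mem fun v hv => ?_)
          (mem_chains_inter.2 ⟨proj_mem_of_mem hz, proj_mem z⟩)
        obtain ⟨hsX, hbs⟩ := hs
        by_cases hvb : v = b
        swap
        · exact Or.inl (Finset.mem_erase.2 ⟨Ne.symm hvb, hbs⟩)
        subst hvb
        refine Or.inr ⟨fun w hw => hlt hsX w (Finset.mem_of_mem_erase hw)
          (Finset.ne_of_mem_erase hw), ?_⟩
        rcases hsX.1.2 with hc | ⟨c, hcW, t, ht, rfl⟩
        · left
          rw [Finset.card_erase_of_mem hbs]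
          omega
        · right
          -- The apex `c` of an added face is its `f`-largest vertex, and so is `v`.
          have hcv : v = c := by
            rcases Finset.mem_insert.1 hbs with h | h
            · exact h
            · exact absurd (hsX.2 c (Finset.mem_insert_self _ _)) ((hB _ t ht).2 h).2.not_ge
          subst hcv
          rwa [Finset.erase_insert fun h => ((hB _ t ht).2 h).2.false]
      refine chains_mono ?_ (mem_chains_inter.2 ⟨h1, h2⟩)
      exact fun s hs => hs.2.resolve_left hs.1
    obtain ⟨w, hw, hdw⟩ := hac _ hY _ hx (totalBoundary_totalBoundary z₁)
    have hcone₁ : cone b z₁ = 0 := by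
      have : cone b z₁ ∈ chains (∅ : Set (Finset V)) :=
        cone_mem_chains (fun s hs hb => absurd hs hb) (proj_mem (U := {s | b ∈ s}) z)
      simpa [chains, supported_empty] using this
    have hcw : totalBoundary V (cone b w) = w - z₁ := by
      have h1 := totalBoundary_cone_add b w
      have h2 := totalBoundary_cone_add b z₁
      rw [hcone₁, map_zero, zero_add] at h2
      rw [hdw, h2] at h1
      exact eq_sub_of_add_eq h1
    -- Replacing `z₁` by `w` changes the cycle by the boundary of `cone b w` and leaves only
    -- vertices before `b`.
    have hzw : z - z₁ + w ∈ chains (X ∩ {s | ↑s ⊆ {w ∈ W | f w < f b} ∩ A}) := by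
      refine add_mem (chains_mono ?_ hz₂) (chains_mono ?_ hw)
      · exact fun s hs => ⟨hs.1.1, fun v hv => hlt hs.1 v hv fun h => hs.2 (h ▸ hv)⟩
      · refine fun s hs => ⟨⟨fun v hv => ⟨(hs.1 hv).1.1, (hs.1 hv).2⟩, Or.inl ?_⟩, hs.1⟩
        rcases hs.2 with h | h
        · omega
        · exact (hB _ s h).1.le
    obtain ⟨c, hc, hzc⟩ := exists_le_mem_chains f hY hzw
    obtain ⟨u, hu, hdu⟩ := ih (f c) hc.1.2 c ⟨hc.1.1, hc.2⟩ rfl _ hzc (by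
      have : z - z₁ + w = z + totalBoundary V (cone b w) := by rw [hcw]; abel
      rw [this, map_add, hdz, totalBoundary_totalBoundary, add_zero])
    have hcwX : cone b w ∈ chains X := by
      refine cone_mem_chains ?_ hw
      intro s hs hb
      refine ⟨fun v hv => ?_, ?_⟩
      · rcases Finset.mem_insert.1 hv with rfl | hv
        · exact ⟨hbW, hbA⟩
        · exact ⟨(hs.1 hv).1.1, (hs.1 hv).2⟩
      · rcases hs.2 with h | h
        · left
          rw [Finset.card_insert_of_notMem hb]
          omega
        · exact Or.inr ⟨b, hbW, s, h, rfl⟩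
    refine ⟨u - cone b w, sub_mem hu hcwX, ?_⟩
    rw [map_sub, hdu, hcw]
    abel
  intro z hz hdz
  obtain ⟨b, hb, hzb⟩ := exists_le_mem_chains f hA
    (mem_chains_inter.2 ⟨hz, chains_mono (fun s hs => hs.1) hz⟩)
  exact key _ b hb rfl z hzb hdz

end Families

theorem exists_injOn_mk_lt {V : Type v} {W : Set V} {κ : Cardinal.{v}} (hκ : κ ≠ 0)
    (hW : #W ≤ κ) : ∃ f : V → κ.ord.ToType, Set.InjOn f W ∧ ∀ i, #{w ∈ W | f w < i} < κ := by
  classical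
  have : Nonempty κ.ord.ToType := by
    rw [← mk_ne_zero_iff]
    simpa using hκ
  obtain ⟨e⟩ : Nonempty (W ↪ κ.ord.ToType) := by
    rw [← Cardinal.le_def]
    simpa using hW
  let f : V → κ.ord.ToType := fun v => if h : v ∈ W then e ⟨v, h⟩ else Classical.arbitrary _
  have hf : Set.InjOn f W := fun v hv w hw h => by
    simp only [f, hv, hw, dif_pos] at h
    exact congrArg Subtype.val (e.injective h)
  refine ⟨f, hf, fun i => ?_⟩
  refine lt_of_le_of_lt ?_ ((mk_Iio_lt i (by simp)).trans_eq (mk_ord_toType κ))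
  refine mk_le_of_injective (f := fun w => (⟨f w.1, w.2.2⟩ : Set.Iio i)) fun v w h => ?_
  exact Subtype.ext (hf v.2.1 w.2.1 (congrArg Subtype.val h))

/-- For `n = 0`, the single added vertex is the maximum of the finite set `W`, because it lies in
every upper set meeting `W`. -/
theorem exists_acyclic_family {V : Type v} [LinearOrder V] (n : ℕ) :
    ∀ W : Set V, #W < ℵ_ (n : Ordinal.{v}) → ∃ B : Set (Finset V),
      (∀ s ∈ B, s.card = n + 1 ∧ (s : Set V) ⊆ W) ∧
      ∀ A : Set V, IsUpperSet A → (W ∩ A).Nonempty → IsAcyclicOn (skeletonWith n W B A) := by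
  induction n with
  | zero =>
    intro W hW
    have hfin : W.Finite := lt_aleph0_iff_set_finite.1 (by simpa using hW)
    by_cases hne : W.Nonempty
    swap
    · exact ⟨∅, by simp, fun A _ h => absurd (h.mono Set.inter_subset_left) hne⟩
    obtain ⟨m, hm, hmax⟩ := hfin.exists_maximalFor id W hne
    refine ⟨{{m}}, by simp [hm], fun A hA ⟨a, haW, haA⟩ z hz hdz => ?_⟩
    have hmA : m ∈ A := hA (by
      rcases le_total a m with h | h
      · exact h
      · exact hmax haW h) haA
    refine ⟨cone m z, cone_mem_chains (fun s hs hb => ?_) hz, totalBoundary_cone_of_cycle m hdz⟩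
    rcases hs.2 with h | h
    · rw [Finset.card_eq_zero.1 (Nat.le_zero.1 h)]
      exact ⟨by simp [hm, hmA], Or.inr (by simp)⟩
    · rw [Set.mem_singleton_iff.1 h] at hb
      exact absurd (Finset.mem_singleton_self m) hb
  | succ n ih =>
    intro W hW
    have hW' : #W ≤ ℵ_ (n : Ordinal.{v}) := by
      rw [← Order.lt_succ_iff, succ_aleph]
      exact_mod_cast hW
    obtain ⟨f, hf, hlt⟩ := exists_injOn_mk_lt (aleph_pos _).ne' hW'
    choose B hB hac using fun i => ih _ (hlt i)
    refine ⟨insertFamily f W B, ?_, fun A hA hne =>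
      isAcyclicOn_insertFamily hf hB (fun i => hac i A hA) hne⟩
    rintro _ ⟨b, hb, t, ht, rfl⟩
    have h := hB _ t ht
    constructor
    · rw [Finset.card_insert_of_notMem fun hbt => (h.2 hbt).2.false, h.1]
    · rw [Finset.coe_insert]
      exact Set.insert_subset hb fun v hv => (h.2 hv).1

/-! ### From homology in each degree to inhomogeneous cycles. -/

section Graded

variable {V : Type*}

theorem mem_chains_proj_card {K : PreAbstractSimplicialComplex V} {k : ℕ} {z : Finset V →₀ ℤ}
    (hz : z ∈ chains K.faces) : proj {s | s.card = k + 1} z ∈ chains (kFaces K k) :=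
  mem_chains_inter.2 ⟨proj_mem_of_mem hz, proj_mem z⟩

theorem card_le_of_dimension_le {K : PreAbstractSimplicialComplex V} {n : ℕ}
    (h : dimension K ≤ (n : ℕ∞)) {s : Finset V} (hs : s ∈ K.faces) : s.card ≤ n + 1 := by
  have hpos := Finset.card_pos.2 (K.isRelLowerSet_faces hs).1
  have hk : (kFaces K (s.card - 1)).Nonempty := ⟨s, hs, by omega⟩
  have h1 : (((s.card - 1 : ℕ) : ℕ∞) : WithBot ℕ∞) ≤ dimension K :=
    le_iSup₂ (f := fun (k : ℕ) (_ : (kFaces K k).Nonempty) => (((k : ℕ∞) : WithBot ℕ∞))) _ hk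
  have h2 : s.card - 1 ≤ n := by exact_mod_cast h1.trans h
  omega

variable [LinearOrder V]

theorem totalBoundary_proj_card (k : ℕ) (z : Finset V →₀ ℤ) :
    totalBoundary V (proj {s | s.card = k + 1} z) = proj {s | s.card = k} (totalBoundary V z) := by
  refine map_proj (U := Set.univ) (fun s hs => ?_) (fun s hs => ?_) (by simp [chains])
  · refine totalBoundary_single_mem fun v hv => ?_
    have h : s.card = k + 1 := hs.2
    simp only [Set.mem_ofPred_eq, Finset.card_erase_of_mem hv]
    omega
  · refine totalBoundary_single_mem fun v hv => ?_
    have h : ¬ s.card = k + 1 := hs.2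
    have := Finset.card_pos.2 ⟨v, hv⟩
    simp only [Set.mem_compl_iff, Set.mem_ofPred_eq, Finset.card_erase_of_mem hv]
    omega

/-- For a complex with vanishing reduced homology, every reduced cycle, homogeneous or not,
is a boundary. -/
theorem isAcyclicOn_faces {K : PreAbstractSimplicialComplex V}
    (h : ∀ k, Subsingleton (ReducedHomology K k)) : IsAcyclicOn K.faces := by
  suffices key : ∀ N, ∀ z ∈ chains K.faces, z ∈ chains {s : Finset V | s.card ≤ N} →
      totalBoundary V z = 0 → ∃ w ∈ chains K.faces, totalBoundary V w = z by
    intro z hz hdz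
    refine key (z.support.sup Finset.card) z hz (mem_chains_iff.2 fun s hs => ?_) hdz
    exact Finset.le_sup (f := Finset.card) (Finsupp.mem_support_iff.2 hs)
  intro N
  induction N with
  | zero =>
    intro z hz hN _
    have hz0 : z = 0 := by
      refine eq_zero_of_mem_chains hz hN (Set.disjoint_left.2 fun s hs h0 => ?_)
      have := Finset.card_pos.2 (K.isRelLowerSet_faces hs).1
      have h0' : s.card ≤ 0 := h0
      omega
    exact ⟨0, zero_mem _, by rw [hz0, map_zero]⟩
  | succ N ih =>
    intro z hz hN hdz
    have htop := mem_chains_proj_card (k := N) hz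
    have hdtop : totalBoundary V (proj {s | s.card = N + 1} z) = 0 := by
      rw [totalBoundary_proj_card, hdz, map_zero]
    obtain ⟨w, hw, hdw⟩ := subsingleton_reducedHomology_iff.1 (h N) _ htop hdtop
    have hlow : z - proj {s | s.card = N + 1} z ∈ chains {s : Finset V | s.card ≤ N} := by
      refine chains_mono (fun s hs => ?_) (sub_proj_mem hN)
      have h1 : s.card ≤ N + 1 := hs.1
      have h2 : ¬ s.card = N + 1 := hs.2
      simp only [Set.mem_ofPred_eq]
      omega
    obtain ⟨w', hw', hdw'⟩ := ih _ (sub_mem hz (proj_mem_of_mem hz)) hlow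
      (by rw [map_sub, hdz, hdtop, sub_zero])
    refine ⟨w + w', add_mem (chains_mono (fun s hs => hs.1) hw) hw', ?_⟩
    rw [map_add, hdw, hdw']
    abel

end Graded

/-! ### No tail-acyclic complex on `ω_n`. -/

section Nonexistence

variable {V : Type v} [LinearOrder V]

/-- The least element of a nonempty finite set. -/
noncomputable def leastVertex [Nonempty V] (s : Finset V) : V :=
  if h : s.Nonempty then s.min' h else Classical.arbitrary V

theorem le_leastVertex_iff [Nonempty V] {s : Finset V} (h : s.Nonempty) {a : V} :
    a ≤ leastVertex s ↔ ∀ v ∈ s, a ≤ v := by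
  rw [leastVertex, dif_pos h, Finset.le_min'_iff]

/-- Projecting to `K.faces` drops the augmentation, so vanishing reduced homology becomes homology ℤ
in degree 0, generated at level `α` by the vertex `α`. The truncated subtraction in the degree is
harmless, since the empty set is not a face. -/
theorem constantHomology_of_tailAcyclic [OrderBot V] {K : AbstractSimplicialComplex V}
    (hK : ∀ (α : V) (k : ℕ),
      Subsingleton (ReducedHomology (restrict K.toPreAbstractSimplicialComplex (Set.Ici α)) k)) :
    ConstantHomology leastVertex (fun s : Finset V => s.card - 1) K.faces Set.univ
      (proj K.faces ∘ₗ totalBoundary V) 0 := by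
  have hne : ∀ {s}, s ∈ K.faces → s.Nonempty := fun hs => (K.isRelLowerSet_faces hs).1
  have hge : ∀ α, K.faces ∩ {s | α ≤ leastVertex s} =
      (restrict K.toPreAbstractSimplicialComplex (Set.Ici α)).faces := fun α => by
    ext s
    constructor
    · exact fun hs => ⟨hs.1, (le_leastVertex_iff (hne hs.1)).1 hs.2⟩
    · exact fun hs => ⟨hs.1, (le_leastVertex_iff (hne hs.1)).2 hs.2⟩
  have hac : ∀ α, IsAcyclicOn (K.faces ∩ {s | α ≤ leastVertex s}) := fun α => by
    rw [hge]
    exact isAcyclicOn_faces (hK α)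
  have hacK : IsAcyclicOn K.faces := by
    have h : K.faces ∩ {s | ⊥ ≤ leastVertex s} = K.faces :=
      Set.inter_eq_left.2 fun s _ => Set.mem_ofPred.2 bot_le
    exact h ▸ hac ⊥
  have hpe : ∀ a : ℤ, proj K.faces (single ∅ a) = 0 := fun a =>
    proj_eq_zero (single_mem_supported ℤ a fun h => Finset.not_nonempty_empty (hne h))
  have hde : ∀ a : ℤ, totalBoundary V (single ∅ a) = 0 := fun a => by simp [totalBoundary]
  have hdec : ∀ x ∈ chains K.faces, ∃ a : ℤ,
      totalBoundary V x = proj K.faces (totalBoundary V x) + single ∅ a := by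
    intro x hx
    have h1 : totalBoundary V x ∈ chains (K.faces ∪ {∅}) := by
      refine map_mem_chains (fun s hs => totalBoundary_single_mem fun v hv => ?_) hx
      rcases Finset.eq_empty_or_nonempty (s.erase v) with h | h
      · exact Or.inr h
      · exact Or.inl ((K.isRelLowerSet_faces hs).2 (Finset.erase_subset _ _) h)
    obtain ⟨y, hy, t, ht, e⟩ := exists_add_of_mem_chains_union h1
    rw [chains, supported_eq_span_single, Set.image_singleton, Submodule.mem_span_singleton] at ht
    obtain ⟨a, rfl⟩ := ht
    refine ⟨a, ?_⟩
    rw [smul_single, smul_eq_mul, mul_one] at e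
    rw [e, map_add, hpe, add_zero, proj_of_mem hy]
  have hvert : ∀ α : V, totalBoundary V (single {α} 1) = single ∅ 1 := fun α => by
    simp [totalBoundary_single, position, Finset.filter_singleton]
  have hcyc : ∀ x ∈ chains K.faces, totalBoundary V (proj K.faces (totalBoundary V x)) = 0 := by
    intro x hx
    obtain ⟨a, ha⟩ := hdec x hx
    have := totalBoundary_totalBoundary x
    rwa [ha, map_add, hde, add_zero] at this
  refine ⟨?_, ?_, fun _ _ => Set.mem_univ _, ?_, ?_, ?_⟩
  · intro s hs
    rw [LinearMap.comp_apply]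
    have h1 : totalBoundary V (single s 1) ∈ chains {t | ∃ v ∈ s, t = s.erase v} :=
      totalBoundary_single_mem fun v hv => ⟨v, hv, rfl⟩
    refine chains_mono ?_ (mem_chains_inter.2 ⟨proj_mem (U := K.faces) _, proj_mem_of_mem h1⟩)
    rintro _ ⟨ht, v, hv, rfl⟩
    refine ⟨ht, (le_leastVertex_iff (hne ht)).2 fun w hw =>
      (le_leastVertex_iff (hne hs)).1 le_rfl w (Finset.mem_of_mem_erase hw), ?_⟩
    have := Finset.card_pos.2 (hne ht)
    rw [Finset.card_erase_of_mem hv] at this ⊢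
    omega
  · intro x hx
    rw [LinearMap.comp_apply, LinearMap.comp_apply, hcyc x hx, map_zero]
  · intro α _ y hy hq
    obtain ⟨w, hw, e⟩ := hac α _ hq (hcyc y hy)
    exact ⟨w, hw, by rw [LinearMap.comp_apply, e, proj_of_mem (mem_chains_inter.1 hq).1]⟩
  · intro α _ z hz hdz
    obtain ⟨a, ha⟩ := hdec z hz
    rw [LinearMap.comp_apply] at hdz
    rw [hdz, zero_add] at ha
    have hα : a • single {α} 1 ∈ chains (K.faces ∩ {s | α ≤ leastVertex s}) :=
      Submodule.smul_mem _ a (single_mem_supported ℤ 1 ⟨K.singleton_mem α,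
        (le_leastVertex_iff (Finset.singleton_nonempty α)).2 (by simp)⟩)
    have hsub := sub_mem hz (mem_chains_inter.1 hα).1
    obtain ⟨y, hy, e⟩ := hacK (z - a • single {α} 1) hsub (by
      rw [map_sub, map_smul, hvert, ha, smul_single, smul_eq_mul, mul_one, sub_self])
    refine ⟨_, hα, y, hy, ?_⟩
    rw [LinearMap.comp_apply, e, proj_of_mem hsub]
    abel
  · have hbot : single {⊥} 1 ∈ chains K.faces := single_mem_supported ℤ 1 (K.singleton_mem ⊥)
    refine ⟨single {⊥} 1, mem_chains_inter.2 ⟨hbot, single_mem_supported ℤ 1 (by simp)⟩, ?_, ?_⟩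
    · rw [LinearMap.comp_apply, hvert, hpe]
    · intro y hy e
      have := hcyc y hy
      rw [LinearMap.comp_apply] at e
      rw [e, hvert] at this
      simp at this

end Nonexistence

theorem not_supports_omega (n : ℕ) : ¬ Supports n (Ordinal.omega (n : Ordinal.{u})) := by
  rintro ⟨K, hdim, hK⟩
  have hbot : (0 : Ordinal.{u}) < Ordinal.omega (n : Ordinal.{u}) := Ordinal.omega_pos _
  let _ : OrderBot (Set.Iio (Ordinal.omega (n : Ordinal.{u}))) :=
    { bot := ⟨0, hbot⟩, bot_le := fun a => bot_le (a := a.1) }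
  refine (constantHomology_of_tailAcyclic hK.acyclic).false_of_strictlyBounded n
    (strictlyBounded_univ ?_) fun s hs => ?_
  · rw [Ordinal.cof_Iio, ← Ordinal.lift_cof, (isRegular_aleph_natCast n).cof_omega_eq]
    simp
  · have := card_le_of_dimension_le hdim hs
    omega

/-! ### Complexes below `ω_n`, and exact dimension. -/

section Existence

variable {V : Type*}

/-- The complex on `V` with complete `(n - 1)`-skeleton and the `n`-faces in `B`. -/
def skeletonComplex {n : ℕ} (hn : 0 < n) (B : Set (Finset V)) (hB : ∀ s ∈ B, s.card = n + 1) :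
    AbstractSimplicialComplex V where
  faces := {s | s.Nonempty ∧ (s.card ≤ n ∨ s ∈ B)}
  isRelLowerSet_faces := fun s hs => ⟨hs.1, fun t hts ht => ⟨ht, by
    rcases hs.2 with h | h
    · exact Or.inl ((Finset.card_le_card hts).trans h)
    · by_cases hts' : t = s
      · exact Or.inr (hts' ▸ h)
      · have h1 := Finset.card_lt_card (lt_of_le_of_ne hts hts')
        have h2 := hB s h
        left
        omega⟩⟩
  singleton_mem := fun v => ⟨Finset.singleton_nonempty v, Or.inl (by rwa [Finset.card_singleton])⟩

theorem dimension_skeletonComplex_le {n : ℕ} (hn : 0 < n) (B : Set (Finset V))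
    (hB : ∀ s ∈ B, s.card = n + 1) :
    dimension (skeletonComplex hn B hB).toPreAbstractSimplicialComplex ≤ (n : ℕ∞) := by
  refine iSup₂_le fun k ⟨s, hs, hc⟩ => ?_
  have h : k ≤ n := by
    rcases hs.2 with h | h
    · omega
    · have := hB s h
      omega
  exact_mod_cast h

theorem isTailAcyclic_skeletonComplex [LinearOrder V] {n : ℕ} (hn : 0 < n) {B : Set (Finset V)}
    (hB : ∀ s ∈ B, s.card = n + 1)
    (hac : ∀ A : Set V, IsUpperSet A → (Set.univ ∩ A).Nonempty →
      IsAcyclicOn (skeletonWith n Set.univ B A)) :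
    IsTailAcyclic n (skeletonComplex hn B hB) := by
  refine ⟨fun s hs => ⟨Finset.card_pos.1 (by omega), Or.inl hs.le⟩, fun α k => ?_⟩
  refine subsingleton_reducedHomology_iff.2 fun z hz hdz => ?_
  have hzX : z ∈ chains (skeletonWith n Set.univ B (Set.Ici α)) := by
    refine chains_mono ?_ hz
    exact fun s hs => ⟨Set.subset_inter (Set.subset_univ _) hs.1.2, hs.1.1.2⟩
  obtain ⟨w, hw, rfl⟩ := hac (Set.Ici α) (isUpperSet_Ici α) ⟨α, Set.mem_univ α, le_rfl⟩ z hzX hdz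
  refine ⟨proj {s | s.card = k + 1 + 1} w, ?_, ?_⟩
  · refine chains_mono ?_ (mem_chains_inter.2 ⟨proj_mem_of_mem hw, proj_mem w⟩)
    rintro s ⟨hs, hc⟩
    have hc' : s.card = k + 1 + 1 := hc
    exact ⟨⟨⟨Finset.card_pos.1 (by omega), hs.2⟩, hs.1.trans Set.inter_subset_right⟩, hc⟩
  · rw [totalBoundary_proj_card, proj_of_mem]
    exact chains_mono (fun s hs => hs.2) hz

end Existence

theorem supports_of_lt_omega {n : ℕ} (hn : 0 < n) {γ : Ordinal.{u}}
    (hγ : γ < Ordinal.omega (n : Ordinal.{u})) : Supports n γ := by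
  have hc : #(Set.univ : Set (Set.Iio γ)) < ℵ_ (n : Ordinal.{u + 1}) := by
    rw [mk_univ, mk_Iio_ordinal]
    have h := Cardinal.lift_lt.{u, u + 1}.2 (lt_omega_iff_card_lt.1 hγ)
    simpa using h
  obtain ⟨B, hB, hac⟩ := exists_acyclic_family n Set.univ hc
  exact ⟨skeletonComplex hn B fun s hs => (hB s hs).1, dimension_skeletonComplex_le _ _ _,
    isTailAcyclic_skeletonComplex hn _ hac⟩

/-- The boundary of the simplex `s` lies in the complete `(n-1)`-skeleton of the tail starting at
its least vertex, so it bounds there. Without `n`-faces it would be zero, which the cone formula at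
a vertex of `s` rules out. -/
theorem IsTailAcyclic.kFaces_nonempty {V : Type*} [LinearOrder V] {n : ℕ} (hn : 0 < n)
    {K : AbstractSimplicialComplex V} (hK : IsTailAcyclic n K) {s : Finset V}
    (hs : s.card = n + 1) : (kFaces K.toPreAbstractSimplicialComplex n).Nonempty := by
  by_contra hempty
  obtain ⟨k, rfl⟩ := Nat.exists_eq_succ_of_ne_zero hn.ne'
  have hne : s.Nonempty := Finset.card_pos.1 (by omega)
  obtain ⟨b, hb⟩ := hne
  set K' := restrict K.toPreAbstractSimplicialComplex (Set.Ici (s.min' ⟨b, hb⟩))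
  have hmem : totalBoundary V (single s 1) ∈ chains (kFaces K' k) := by
    refine totalBoundary_single_mem fun v hv => ?_
    have hc : (s.erase v).card = k + 1 := by
      rw [Finset.card_erase_of_mem hv]
      omega
    exact ⟨⟨hK.complete_skeleton _ hc, fun w hw => s.min'_le w (Finset.mem_of_mem_erase hw)⟩, hc⟩
  obtain ⟨w, hw, hdw⟩ := subsingleton_reducedHomology_iff.1 (hK.acyclic _ k) _ hmem
    (totalBoundary_totalBoundary _)
  have hw0 : w = 0 := by
    ext t
    by_contra ht
    have := mem_chains_iff.1 hw t ht
    exact hempty ⟨t, this.1.1, this.2⟩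
  have h := totalBoundary_cone_add b (single s 1)
  rw [← hdw, hw0, map_zero, map_zero, cone_single_of_mem hb, map_zero, add_zero] at h
  simp [eq_comm] at h

theorem Supports.supportsExactly {n : ℕ} (hn : 0 < n) {γ : Ordinal.{u}} (hγ : (n : Ordinal.{u}) < γ)
    (h : Supports n γ) : SupportsExactly n γ := by
  obtain ⟨K, hdim, hK⟩ := h
  have hlt : ∀ i : Fin (n + 1), ((i : ℕ) : Ordinal.{u}) < γ := fun i =>
    lt_of_le_of_lt (by exact_mod_cast Nat.lt_succ_iff.1 i.2) hγ
  let e : Fin (n + 1) ↪ Set.Iio γ := ⟨fun i => ⟨(i : ℕ), hlt i⟩, fun i j hij => by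
    have h : ((i : ℕ) : Ordinal.{u}) = (j : ℕ) := congrArg Subtype.val hij
    exact Fin.ext (by exact_mod_cast h)⟩
  have hne := hK.kFaces_nonempty hn (s := Finset.univ.map e) (by simp)
  refine ⟨K, le_antisymm hdim ?_, hK⟩
  exact le_iSup₂ (f := fun (k : ℕ) (_ : (kFaces K.toPreAbstractSimplicialComplex k).Nonempty) =>
    (((k : ℕ∞) : WithBot ℕ∞))) n hne

theorem SupportsExactly.supports {n : ℕ} {γ : Ordinal.{u}} (h : SupportsExactly n γ) :
    Supports n γ := by
  obtain ⟨K, hdim, hK⟩ := h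
  exact ⟨K, hdim.le, hK⟩

end TailAcyclic

theorem mainTheorem1 (n : ℕ) (hn : 0 < n) :
    IsLeast {γ : Ordinal.{u} | ¬ TailAcyclic.Supports n γ} (Ordinal.omega (n : Ordinal.{u})) ∧
    IsLeast {γ : Ordinal.{u} | (n : Ordinal.{u}) < γ ∧ ¬ TailAcyclic.SupportsExactly n γ}
      (Ordinal.omega (n : Ordinal.{u})) := by
  have hnot := TailAcyclic.not_supports_omega.{u} n
  refine ⟨⟨hnot, fun γ hγ => ?_⟩, ⟨⟨?_, fun h => hnot h.supports⟩, fun γ hγ => ?_⟩⟩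
  · by_contra h
    exact hγ (TailAcyclic.supports_of_lt_omega hn (not_le.1 h))
  · exact (Ordinal.natCast_lt_omega0 n).trans_le (Ordinal.omega0_le_omega _)
  · by_contra h
    exact hγ.2 ((TailAcyclic.supports_of_lt_omega hn (not_le.1 h)).supportsExactly hn hγ.1)
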